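/- Let $G$ be a countable discrete group, equipped with a right-invariant metric $d$ of bounded geometry, i.e. such that for every $r>0$ the cardinalities of the balls $B(x,r)$, $x\in G$, are finite and uniformly bounded. (Every countable group has such a metric.) $(G,d)$ has *property A* if for all $R,\epsilon>0$ there are finite non-empty sets $A_x\subseteq G\times\mathbb{N}$ $(x\in G)$ and $S\in\mathbb{R}$ such that $|A_x\triangle A_y|<\epsilon\,|A_x\cap A_y|$ whenever $d(x,y)\le R$, and $d(x,y)\le S$ whenever $(y,n)\in A_x$. $C^*_r(G)$ is the norm closure in $\mathcal{B}(\ell^2(G))$ of $\lambda(\mathbb{C}[G])$, where $\lambda$ is the left regular representation $(\lambda_g f)(h)=f(g^{-1}h)$. $C^*_u(G)$, the uniform Roe algebra of $(G,d)$, is the norm closure in $\mathcal{B}(\ell^2(G))$ of the $*$-algebra of operators $T$ of finite propagation: for some $S\ge 0$, $\langle T\delta_y,\delta_x\rangle=0$ whenever $d(x,y)>S$. A linear map $\theta:A\to B$ of unital $C^*$-algebras is *nuclear* if for every finite $F\subseteq A$ and $\epsilon>0$ there are $n$ and unital completely positive maps $\phi:A\to M_n(\mathbb{C})$, $\psi:M_n(\mathbb{C})\to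 B$ with $\|\theta(a)-\psi(\phi(a))\|<\epsilon$ for all $a\in F$. A unital $C^*$-algebra $A$ is *nuclear* if $\mathrm{id}_A$ is a nuclear map, and *exact* if there are a Hilbert space $\mathcal{H}$ and a faithful representation $A\to\mathcal{B}(\mathcal{H})$ that is a nuclear map. Then the following are equivalent: 1. $C^*_r(G)$ is exact; 2. $G$ (with the metric $d$) has property A; 3. $C^*_u(G)$ is nuclear; 4. $C^*_u(G)$ is exact. -/

import Mathlib

open scoped ComplexOrder lp

noncomputable section

universe u v

/-! ### Coarse geometry -/

/-- A metric space has bounded geometry if, for each radius, the cardinalities of all balls of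
that radius are finite and uniformly bounded. -/
def BoundedGeometry (X : Type u) [MetricSpace X] : Prop :=
  ∀ r : ℝ, 0 < r → ∃ N : ℕ, ∀ x : X, (Metric.ball x r).encard < N

/-- The metric of `G` is invariant under right translations. -/
def RightInvariantDist (G : Type u) [Group G] [MetricSpace G] : Prop :=
  ∀ g x y : G, dist (x * g) (y * g) = dist x y

open Classical in
/-- Yu's property A. The inequality `|A x ∆ A y| / |A x ∩ A y| < ε` is written without
division, so that it forces `A x ∩ A y` to be non-empty. -/
def PropertyA (X : Type u) [MetricSpace X] : Prop :=
  ∀ R ε : ℝ, 0 < R → 0 < ε → ∃ A : X → Finset (X × ℕ),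
    (∀ x, (A x).Nonempty) ∧
    (∀ x y, dist x y ≤ R →
      ((symmDiff (A x) (A y)).card : ℝ) < ε * ((A x ∩ A y).card : ℝ)) ∧
    ∃ S : ℝ, ∀ x, ∀ p ∈ A x, dist x p.1 ≤ S

/-! ### Nuclear maps, nuclear and exact algebras -/

/-- A linear map of unital C⋆-algebras is nuclear if it can be approximated, on finite sets, by
compositions of unital completely positive maps through matrix algebras `M_n(ℂ)`. -/
def IsNuclearMap {A : Type u} {B : Type v}
    [CStarAlgebra A] [PartialOrder A] [StarOrderedRing A]
    [CStarAlgebra B] [PartialOrder B] [StarOrderedRing B] (θ : A →ₗ[ℂ] B) : Prop :=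
  ∀ (F : Finset A) (ε : ℝ), 0 < ε →
    ∃ (n : ℕ) (φ : CompletelyPositiveMap A (CStarMatrix (Fin n) (Fin n) ℂ))
      (ψ : CompletelyPositiveMap (CStarMatrix (Fin n) (Fin n) ℂ) B),
      φ 1 = 1 ∧ ψ 1 = 1 ∧ ∀ a ∈ F, ‖θ a - ψ (φ a)‖ < ε

/-- A unital C⋆-algebra is nuclear if its identity map is a nuclear map. -/
def IsNuclearAlgebra (A : Type u) [CStarAlgebra A] [PartialOrder A] [StarOrderedRing A] : Prop :=
  IsNuclearMap (LinearMap.id : A →ₗ[ℂ] A)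

/-- A unital C⋆-algebra is exact if it has a faithful representation on some Hilbert space that
is a nuclear map. -/
def IsExactAlgebra (A : Type u) [CStarAlgebra A] [PartialOrder A] [StarOrderedRing A] : Prop :=
  ∃ (H : Type u) (_ : NormedAddCommGroup H) (_ : InnerProductSpace ℂ H) (_ : CompleteSpace H)
    (π : A →⋆ₐ[ℂ] (H →L[ℂ] H)), Function.Injective π ∧ IsNuclearMap (π : A →ₗ[ℂ] (H →L[ℂ] H))

/-- On a closed star subalgebra of `B(H)`, the order inherited from `B(H)` is the order of the
C⋆-algebra: its positive elements have positive square roots inside the subalgebra. -/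
theorem starOrderedRing_of_isClosed {H : Type u} [NormedAddCommGroup H] [InnerProductSpace ℂ H]
    [CompleteSpace H] (S : StarSubalgebra ℂ (H →L[ℂ] H)) (hS : IsClosed (S : Set (H →L[ℂ] H))) :
    StarOrderedRing S := by
  refine StarOrderedRing.of_nonneg_iff' (fun {x y} h z => ?_) fun x => ⟨fun hx => ?_, ?_⟩
  · exact Subtype.coe_le_coe.1 (add_le_add_right (Subtype.coe_le_coe.2 h) (z : H →L[ℂ] H))
  · have hx' : (0 : H →L[ℂ] H) ≤ x := hx
    have hsa : IsSelfAdjoint (x : H →L[ℂ] H) := .of_nonneg hx'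
    refine ⟨⟨cfc Real.sqrt (x : H →L[ℂ] H), cfc_mem (𝕜' := ℂ) _ x.2⟩, ?_⟩
    · apply Subtype.ext
      change (x : H →L[ℂ] H) = star (cfc Real.sqrt (x : H →L[ℂ] H)) * cfc Real.sqrt (x : H →L[ℂ] H)
      rw [← cfc_star, ← cfc_mul ..]
      conv_lhs => rw [← cfc_id ℝ (x : H →L[ℂ] H)]
      refine cfc_congr fun t ht => ?_
      simp [Real.mul_self_sqrt (spectrum_nonneg_of_nonneg hx' ht)]
  · rintro ⟨s, rfl⟩
    exact Subtype.coe_le_coe.1 (star_mul_self_nonneg (s : H →L[ℂ] H))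

/-! ### The uniform Roe algebra -/

/-- The basis vector `δ_x` of `ℓ²(X)`. -/
def deltaVec {X : Type u} (x : X) : ℓ²(X, ℂ) :=
  haveI := Classical.decEq X
  lp.single 2 x 1

/-- `T` has finite propagation: for some `S`, the matrix entries `⟨δ_x, T δ_y⟩`, that is the
operators `P_{x} T P_{y}`, vanish whenever `dist x y > S`. -/
def FinitePropagation {X : Type u} [MetricSpace X] (T : ℓ²(X, ℂ) →L[ℂ] ℓ²(X, ℂ)) : Prop :=
  ∃ S : ℝ, 0 ≤ S ∧ ∀ x y : X, S < dist x y → inner ℂ (deltaVec x) (T (deltaVec y)) = 0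

theorem inner_deltaVec {X : Type u} (x : X) (f : ℓ²(X, ℂ)) : inner ℂ (deltaVec x) f = f x := by
  classical
  simp [deltaVec, lp.inner_single_left]

/-- The star algebra of finite propagation operators on `ℓ²(X)`. -/
def finitePropagationAlgebra (X : Type u) [MetricSpace X] :
    StarSubalgebra ℂ (ℓ²(X, ℂ) →L[ℂ] ℓ²(X, ℂ)) where
  carrier := {T | FinitePropagation T}
  mul_mem' := by
    rintro T U ⟨r, hr, hT⟩ ⟨s, hs, hU⟩
    refine ⟨r + s, add_nonneg hr hs, fun x y hxy => ?_⟩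
    rw [mul_apply_eq_comp, ← ContinuousLinearMap.adjoint_inner_left,
      lp.inner_eq_tsum]
    convert tsum_zero with z
    rw [← inner_deltaVec z (U _), ← inner_deltaVec z (ContinuousLinearMap.adjoint T _),
      ContinuousLinearMap.adjoint_inner_right]
    by_cases h : r < dist x z
    · rw [← inner_conj_symm (T _), hT x z h]
      simp
    · rw [hU z y (by linarith [dist_triangle x z y])]
      simp
  add_mem' := by
    rintro T U ⟨r, hr, hT⟩ ⟨s, hs, hU⟩
    refine ⟨max r s, le_max_of_le_left hr, fun x y hxy => ?_⟩
    rw [add_apply, inner_add_right,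
      hT x y ((le_max_left r s).trans_lt hxy), hU x y ((le_max_right r s).trans_lt hxy), add_zero]
  algebraMap_mem' := by
    intro c
    refine ⟨0, le_rfl, fun x y hxy => ?_⟩
    classical
    have h : x ≠ y := dist_pos.1 hxy
    rw [inner_deltaVec]
    simp [Algebra.algebraMap_eq_smul_one, deltaVec, h]
  star_mem' := by
    rintro T ⟨r, hr, hT⟩
    refine ⟨r, hr, fun x y hxy => ?_⟩
    rw [ContinuousLinearMap.star_eq_adjoint, ContinuousLinearMap.adjoint_inner_right,
      ← inner_conj_symm, hT y x (by rwa [dist_comm]), map_zero]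

/-- The uniform Roe algebra `C⋆_u(X)`: the norm closure of the finite propagation operators. -/
def uniformRoeAlgebra (X : Type u) [MetricSpace X] :
    StarSubalgebra ℂ (ℓ²(X, ℂ) →L[ℂ] ℓ²(X, ℂ)) :=
  (finitePropagationAlgebra X).topologicalClosure

instance isClosed_uniformRoeAlgebra (X : Type u) [MetricSpace X] :
    IsClosed (uniformRoeAlgebra X : Set (ℓ²(X, ℂ) →L[ℂ] ℓ²(X, ℂ))) :=
  (finitePropagationAlgebra X).isClosed_topologicalClosure

instance starOrderedRing_uniformRoeAlgebra (X : Type u) [MetricSpace X] :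
    StarOrderedRing (uniformRoeAlgebra X) :=
  starOrderedRing_of_isClosed _ inferInstance

/-! ### The reduced group C⋆-algebra -/

/-- Left translation `(λ_g f)(h) = f (g⁻¹ h)` as a linear isometry of `ℓ²(G)`. -/
def leftTranslation {G : Type u} [Group G] (g : G) : ℓ²(G, ℂ) →ₗᵢ[ℂ] ℓ²(G, ℂ) where
  toFun f := ⟨fun h => f (g⁻¹ * h), by
    have hf := (memℓp_gen_iff (by norm_num)).1 (lp.memℓp f)
    exact (memℓp_gen_iff (by norm_num)).2 (hf.comp_injective (mul_right_injective g⁻¹))⟩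
  map_add' _ _ := rfl
  map_smul' _ _ := rfl
  norm_map' f := by
    rw [lp.norm_eq_tsum_rpow (by norm_num), lp.norm_eq_tsum_rpow (by norm_num)]
    congr 1
    exact (Equiv.mulLeft g⁻¹).tsum_eq fun h => ‖f h‖ ^ (2 : ENNReal).toReal

/-- The left regular representation `λ : G → B(ℓ²(G))`. -/
def leftRegular (G : Type u) [Group G] : G →* (ℓ²(G, ℂ) →L[ℂ] ℓ²(G, ℂ)) where
  toFun g := (leftTranslation g).toContinuousLinearMap
  map_one' := by
    ext f h
    change f (1⁻¹ * h) = f h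
    simp
  map_mul' a b := by
    ext f h
    change f ((a * b)⁻¹ * h) = f (b⁻¹ * (a⁻¹ * h))
    simp [mul_assoc]

theorem star_leftRegular {G : Type u} [Group G] (g : G) :
    star (leftRegular G g) = leftRegular G g⁻¹ := by
  rw [ContinuousLinearMap.star_eq_adjoint, eq_comm, ContinuousLinearMap.eq_adjoint_iff]
  intro f f'
  have h : f' = leftRegular G g⁻¹ (leftRegular G g f') := by
    rw [← mul_apply_eq_comp, ← map_mul]
    simp
  conv_lhs => rw [h]
  exact (leftTranslation g⁻¹).inner_map_map f _

/-- The image `λ(ℂ[G])` of the group algebra, as a star subalgebra of `B(ℓ²(G))`. -/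
def groupAlgebraImage (G : Type u) [Group G] :
    StarSubalgebra ℂ (ℓ²(G, ℂ) →L[ℂ] ℓ²(G, ℂ)) where
  toSubalgebra := (MonoidAlgebra.lift ℂ (ℓ²(G, ℂ) →L[ℂ] ℓ²(G, ℂ)) G (leftRegular G)).range
  star_mem' := by
    rintro _ ⟨a, rfl⟩
    change star (MonoidAlgebra.lift ℂ _ G (leftRegular G) a) ∈ AlgHom.range _
    rw [MonoidAlgebra.lift_apply, Finsupp.sum, star_sum]
    refine sum_mem fun g _ => ?_
    rw [star_smul, star_leftRegular]
    exact Subalgebra.smul_mem _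
      ((AlgHom.mem_range _).2 ⟨MonoidAlgebra.of ℂ G g⁻¹, MonoidAlgebra.lift_of _ _⟩) _

/-- The reduced C⋆-algebra `C⋆_r(G)`: the norm closure of `λ(ℂ[G])` in `B(ℓ²(G))`. -/
def reducedGroupAlgebra (G : Type u) [Group G] :
    StarSubalgebra ℂ (ℓ²(G, ℂ) →L[ℂ] ℓ²(G, ℂ)) :=
  (groupAlgebraImage G).topologicalClosure

instance isClosed_reducedGroupAlgebra (G : Type u) [Group G] :
    IsClosed (reducedGroupAlgebra G : Set (ℓ²(G, ℂ) →L[ℂ] ℓ²(G, ℂ))) :=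
  (groupAlgebraImage G).isClosed_topologicalClosure

instance starOrderedRing_reducedGroupAlgebra (G : Type u) [Group G] :
    StarOrderedRing (reducedGroupAlgebra G) :=
  starOrderedRing_of_isClosed _ inferInstance

open Pointwise in
/-- Every countable group carries a right-invariant metric of bounded geometry. -/
theorem exists_rightInvariant_boundedGeometry (G : Type u) [Group G] [Countable G] :
    ∃ _ : MetricSpace G, RightInvariantDist G ∧ BoundedGeometry G := by
  classical
  obtain ⟨f, hf⟩ := exists_injective_nat G
  let s : ℕ → Set G := fun n => insert 1 {g | f g ≤ n ∨ f g⁻¹ ≤ n}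
  have hfin : ∀ n, (s n).Finite := fun n =>
    (((Set.finite_Iic n).preimage hf.injOn).union
      ((Set.finite_Iic n).preimage (hf.comp inv_injective).injOn)).insert 1
  have hone : ∀ n, (1 : G) ∈ s n := fun n => Set.mem_insert _ _
  have hmono : Monotone s := fun m n h => Set.insert_subset_insert
    fun g hg => hg.imp (le_trans · h) (le_trans · h)
  have hsymm : ∀ n, (s n)⁻¹ = s n := fun n => by
    ext g; simp [s, or_comm]
  have hex : ∀ g, ∃ n, g ∈ s n ^ n := fun g => ⟨f g + 1, by
    have : g ∈ s (f g + 1) := Or.inr (Or.inl (Nat.le_succ _))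
    exact Set.subset_pow (hone _) (Nat.succ_ne_zero _) this⟩
  let len : G → ℕ := fun g => Nat.find (hex g)
  have hlen : ∀ g, g ∈ s (len g) ^ len g := fun g => Nat.find_spec (hex g)
  have hle : ∀ g n, g ∈ s n ^ n → len g ≤ n := fun g n h => Nat.find_min' (hex g) h
  have hone' : len 1 = 0 := Nat.le_zero.1 (hle 1 0 (by simp))
  have hmul : ∀ g h, len (g * h) ≤ len g + len h := fun g h => hle _ _ <| by
    rw [pow_add]
    exact Set.mul_mem_mul (Set.pow_subset_pow_left (hmono (by omega)) (hlen g))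
      (Set.pow_subset_pow_left (hmono (by omega)) (hlen h))
  have hinv : ∀ g, len g⁻¹ ≤ len g := fun g => hle _ _ <| by
    rw [← hsymm, inv_pow]
    exact Set.inv_mem_inv.2 (hlen g)
  let m : MetricSpace G :=
    { dist := fun x y => len (x * y⁻¹)
      dist_self := fun x => by simp [hone']
      dist_comm := fun x y => by
        have h : ∀ x y, len (x * y⁻¹) ≤ len (y * x⁻¹) := fun x y => by
          simpa using hinv (y * x⁻¹)
        exact congrArg _ (le_antisymm (h x y) (h y x))
      dist_triangle := fun x y z => by
        have := hmul (x * y⁻¹) (y * z⁻¹)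
        simp only [inv_mul_cancel_right, ← mul_assoc] at this
        exact_mod_cast this
      eq_of_dist_eq_zero := fun {x y} h => by
        have h0 : len (x * y⁻¹) = 0 := by exact_mod_cast h
        have := hlen (x * y⁻¹)
        rw [h0, pow_zero, Set.mem_one] at this
        exact mul_inv_eq_one.1 this }
  refine ⟨m, fun g x y => ?_, fun r _ => ?_⟩
  · change ((len _ : ℕ) : ℝ) = (len _ : ℕ)
    simp [mul_assoc]
  · obtain ⟨n, hn⟩ := exists_nat_gt r
    have hF : (s n ^ n).Finite := by
      have h : ∀ k, (s n ^ k).Finite := fun k => by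
        induction k with
        | zero => simp
        | succ k ih => rw [pow_succ]; exact ih.mul (hfin n)
      exact h n
    refine ⟨(s n ^ n).ncard + 1, fun x => ?_⟩
    have hsub : Metric.ball x r ⊆ (· * x) '' (s n ^ n) := fun y hy => by
      have hy' : (len (y * x⁻¹) : ℝ) < r := hy
      have hlt : len (y * x⁻¹) ≤ n := by exact_mod_cast (hy'.trans hn).le
      refine ⟨y * x⁻¹, ?_, by simp⟩
      exact Set.pow_subset_pow_right (hone n) hlt
        (Set.pow_subset_pow_left (hmono hlt) (hlen _))
    refine lt_of_le_of_lt ((Set.encard_le_encard hsub).trans (Set.encard_image_le _ _)) ?_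
    rw [← hF.cast_ncard_eq]
    exact_mod_cast Nat.lt_succ_self _

end

-- The implications form a cycle. Composing the approximations of the identity with the inclusion of
-- `C⋆_u(G)` in `B(ℓ²(G))` gives 3 ⇒ 4. Right invariance puts `C⋆_r(G)` inside `C⋆_u(G)`, and a
-- nuclear faithful representation restricts to subalgebras, which gives 4 ⇒ 1.
--
-- For 2 ⇒ 3 (`PropertyA.isNuclearAlgebra`), property A supplies unit vectors `ξ x` in `ℓ²(G)`,
-- supported near `x`, with `⟨ξ x, ξ y⟩` close to `1` when `x` and `y` are close. Finite propagation
-- operators are finite sums of weighted translations. The coefficient functions, read on a ball of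
-- fixed radius around a moving point `z`, take only finitely many values up to a small error, so
-- compressing to the balls around finitely many representatives loses little. Gluing the blocks
-- back with the weights `ξ` sends a weighted translation to a translation by the same element,
-- whose coefficient is an average of nearby values with total weight `⟨ξ x, ξ (s⁻¹ x)⟩`, close to
-- `1`. This is `PropertyA.exists_factorization`.
--
-- For 1 ⇒ 2 (`IsExactAlgebra.propertyA`), let `ψ ∘ φ` approximate a faithful `π` on the unitaries
-- of a ball. By Hahn–Banach, `φ` is nearly a sum of vector functionals of finitely supported
-- vectors (`exists_finitely_supported_approx`); by Choi's argument, `ψ` has a Kraus form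
-- (`CompletelyPositiveMap.exists_kraus`). The coefficients `⟨π(s) v, ψ(φ(λ_{s t⁻¹})) π(t) v⟩` are
-- then, up to a small error, the Gram matrix of vectors `w s` supported near `s`
-- (`sum_inner_kraus_vectors`). They are close to `1` for nearby `s, t`, so `w` varies slowly in
-- `ℓ²`; the squared norms vary slowly in `ℓ¹`, and rounding them to integers produces the sets of
-- property A (`propertyA_of_functions`).

universe u v

noncomputable section

/-! ### Positivity in C⋆-algebras and in matrices over them -/

section Abstract

variable {B : Type u} [NonUnitalCStarAlgebra B] [PartialOrder B] [StarOrderedRing B]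

theorem exists_eq_star_mul_self {b : B} (hb : 0 ≤ b) : ∃ c, b = star c * c :=
  CStarAlgebra.nonneg_iff_eq_star_mul_self.1 hb

/-- A self-adjoint `b` is nonnegative if compressing it by any self-adjoint element never gives
a nontrivial `-(d⋆ d)`. -/
theorem nonneg_of_forall_star_mul_mul_eq_neg {b : B} (hb : IsSelfAdjoint b)
    (h : ∀ a d : B, star a * b * a = -(star d * d) → d = 0) : 0 ≤ b := by
  have hN0 : 0 ≤ b⁻ := CFC.negPart_nonneg b
  have hNsa : star b⁻ = b⁻ := (IsSelfAdjoint.of_nonneg hN0).star_eq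
  obtain ⟨d, hd⟩ := exists_eq_star_mul_self hN0
  have hb' : b⁺ - b⁻ = b := CFC.posPart_sub_negPart b hb
  -- Compressing `b` by its own negative part gives `-(b⁻)³`; with `b⁻ = d⋆ d` this has the
  -- forbidden form, so `d * b⁻ = 0` and hence `b⁻ * b⁻ = 0`.
  have h1 : star b⁻ * b * b⁻ = -(star (d * b⁻) * (d * b⁻)) := by
    have : b⁻ * b = - (b⁻ * b⁻) := by
      have := congrArg (b⁻ * ·) hb'
      simpa only [mul_sub, CFC.negPart_mul_posPart, zero_sub] using this.symm
    rw [hNsa, this, neg_mul, star_mul, hNsa, mul_assoc, mul_assoc]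
    congr 2
    rw [← mul_assoc, ← hd]
  have h2 := h _ _ h1
  have h3 : b⁻ * b⁻ = 0 := by
    conv_lhs => enter [1]; rw [hd]
    rw [mul_assoc, h2, mul_zero]
  have h4 : b⁻ = 0 := by
    rw [← CStarRing.star_mul_self_eq_zero_iff, hNsa, h3]
  rw [← hb', h4, sub_zero]
  exact CFC.posPart_nonneg b

end Abstract

namespace CStarMatrix

theorem sum_apply {ι m n A : Type*} [AddCommMonoid A] (s : Finset ι) (F : ι → CStarMatrix m n A)
    (p : m) (q : n) : (∑ l ∈ s, F l) p q = ∑ l ∈ s, F l p q :=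
  map_sum (⟨⟨fun N => N p q, rfl⟩, fun _ _ => rfl⟩ : CStarMatrix m n A →+ A) F s

variable {A : Type u} [CStarAlgebra A]

theorem sum_inner_star_mul_mul {H : Type v} [NormedAddCommGroup H] [InnerProductSpace ℂ H]
    [CompleteSpace H] {n : Type*} [Fintype n] (ρ : A →⋆ₐ[ℂ] (H →L[ℂ] H))
    (M N : CStarMatrix n n A) (k : n) (ζ : H) :
    ∑ p, ∑ q, inner ℂ (ρ (N p k) ζ) (ρ (M p q) (ρ (N q k) ζ)) =
      inner ℂ ζ (ρ ((star N * M * N) k k) ζ) := by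
  rw [mul_assoc, mul_apply]
  simp only [mul_apply, star_apply, Finset.mul_sum, map_sum, map_mul, map_star,
    _root_.sum_apply, inner_sum]
  refine Finset.sum_congr rfl fun p _ => Finset.sum_congr rfl fun q _ => ?_
  rw [ContinuousLinearMap.star_eq_adjoint, mul_apply_eq_comp, mul_apply_eq_comp,
    ContinuousLinearMap.adjoint_inner_right]

theorem inner_star_mul_self {H : Type v} [NormedAddCommGroup H] [InnerProductSpace ℂ H]
    [CompleteSpace H] {n : Type*} [Fintype n] (ρ : A →⋆ₐ[ℂ] (H →L[ℂ] H))
    (N : CStarMatrix n n A) (k : n) (ζ : H) :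
    inner ℂ ζ (ρ ((star N * N) k k) ζ) = ((∑ p, ‖ρ (N p k) ζ‖ ^ 2 : ℝ) : ℂ) := by
  simp only [mul_apply, star_apply, map_sum, map_mul, map_star, _root_.sum_apply, inner_sum,
    Complex.ofReal_sum]
  refine Finset.sum_congr rfl fun p _ => ?_
  rw [ContinuousLinearMap.star_eq_adjoint, mul_apply_eq_comp,
    ContinuousLinearMap.adjoint_inner_right, inner_self_eq_norm_sq_to_K]
  simp

variable [PartialOrder A] [StarOrderedRing A]

/-- The matrix `(y p)⋆ (y q)` is positive. -/
theorem star_mul_nonneg {n : Type*} [Fintype n] (y : n → A) :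
    0 ≤ (ofMatrix (Matrix.of fun p q => star (y p) * y q) : CStarMatrix n n A) := by
  classical
  rcases isEmpty_or_nonempty n with hn | ⟨⟨p₀⟩⟩
  · exact le_of_eq (ext fun p => hn.elim p)
  · let Z : CStarMatrix n n A := ofMatrix (Matrix.of fun p q => if p = p₀ then y q else 0)
    convert star_mul_self_nonneg Z
    ext p q
    rw [mul_apply, Finset.sum_eq_single p₀]
    · simp [Z, star_apply]
    · intro b _ hb
      simp [Z, hb]
    · simp

/-- A positive matrix is of the form `C⋆ C`, entrywise. -/
theorem exists_apply_eq_sum_star_mul {n : Type*} [Fintype n] {M : CStarMatrix n n A}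
    (hM : 0 ≤ M) : ∃ C : CStarMatrix n n A, ∀ p q, M p q = ∑ l, star (C l p) * C l q := by
  obtain ⟨C, rfl⟩ := exists_eq_star_mul_self hM
  exact ⟨C, fun p q => by simp [mul_apply, star_apply]⟩

/-- Positivity of a matrix over a C⋆-algebra can be tested on the vectors of a faithful
representation. -/
theorem nonneg_of_forall_inner {H : Type v} [NormedAddCommGroup H] [InnerProductSpace ℂ H]
    [CompleteSpace H] {n : Type*} [Fintype n] (ρ : A →⋆ₐ[ℂ] (H →L[ℂ] H))
    (hρ : Function.Injective ρ) {M : CStarMatrix n n A} (hM : IsSelfAdjoint M)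
    (h : ∀ η : n → H, 0 ≤ (∑ p, ∑ q, inner ℂ (η p) (ρ (M p q) (η q))).re) : 0 ≤ M := by
  -- Testing on the vectors `ρ (N p k) ζ` reads off the diagonal entry `(k, k)` of `N⋆ M N = -D⋆ D`,
  -- which is minus a sum of squares `‖ρ (D p k) ζ‖²`. Nonnegativity makes every term vanish.
  refine nonneg_of_forall_star_mul_mul_eq_neg hM fun N D hND => ?_
  ext l k
  refine hρ (ContinuousLinearMap.ext fun ζ => ?_)
  have h1 := h fun p => ρ (N p k) ζ
  rw [sum_inner_star_mul_mul, hND, neg_apply, map_neg, _root_.neg_apply, inner_neg_right,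
    inner_star_mul_self, Complex.neg_re, Complex.ofReal_re, Left.nonneg_neg_iff] at h1
  have h2 := (Finset.sum_eq_zero_iff_of_nonneg fun p _ => by positivity).1
    (le_antisymm h1 (Finset.sum_nonneg fun p _ => by positivity)) l (Finset.mem_univ l)
  simpa using h2

/-- A positive matrix gives a positive quadratic form in every representation. -/
theorem re_sum_inner_nonneg {H : Type v} [NormedAddCommGroup H] [InnerProductSpace ℂ H]
    [CompleteSpace H] {n : Type*} [Fintype n] (ρ : A →⋆ₐ[ℂ] (H →L[ℂ] H))
    {M : CStarMatrix n n A} (hM : 0 ≤ M) (η : n → H) :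
    0 ≤ (∑ p, ∑ q, inner ℂ (η p) (ρ (M p q) (η q))).re := by
  obtain ⟨C, hC⟩ := exists_apply_eq_sum_star_mul hM
  have : ∑ p, ∑ q, inner ℂ (η p) (ρ (M p q) (η q)) =
      ∑ l, inner ℂ (∑ p, ρ (C l p) (η p)) (∑ q, ρ (C l q) (η q)) := by
    simp only [hC, map_sum, map_mul, map_star, _root_.sum_apply, inner_sum, sum_inner]
    rw [Finset.sum_congr rfl fun p _ => Finset.sum_comm, Finset.sum_comm]
    refine Finset.sum_congr rfl fun l _ => ?_
    rw [Finset.sum_comm]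
    refine Finset.sum_congr rfl fun q _ => Finset.sum_congr rfl fun p _ => ?_
    rw [ContinuousLinearMap.star_eq_adjoint, mul_apply_eq_comp,
      ContinuousLinearMap.adjoint_inner_right]
  rw [this, Complex.re_sum]
  exact Finset.sum_nonneg fun l _ => inner_self_nonneg (𝕜 := ℂ)

end CStarMatrix

/-! ### Completely positive maps into and out of matrix algebras -/

section CP

variable {A : Type u} [CStarAlgebra A] [PartialOrder A] [StarOrderedRing A]
variable {B : Type v} [CStarAlgebra B] [PartialOrder B] [StarOrderedRing B]

open CStarMatrix

/-- Composition of completely positive maps. -/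
def CompletelyPositiveMap.comp {C : Type*} [CStarAlgebra C] [PartialOrder C] [StarOrderedRing C]
    (ψ : CompletelyPositiveMap B C) (φ : CompletelyPositiveMap A B) :
    CompletelyPositiveMap A C where
  toLinearMap := (ψ : B →ₗ[ℂ] C) ∘ₗ (φ : A →ₗ[ℂ] B)
  map_cstarMatrix_nonneg' k M hM :=
    ψ.map_cstarMatrix_nonneg' k _ (φ.map_cstarMatrix_nonneg' k M hM)

theorem CompletelyPositiveMap.comp_apply {C : Type*} [CStarAlgebra C] [PartialOrder C]
    [StarOrderedRing C] (ψ : CompletelyPositiveMap B C) (φ : CompletelyPositiveMap A B) (a : A) :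
    ψ.comp φ a = ψ (φ a) := rfl

/-- A star homomorphism as a completely positive map. -/
def StarAlgHom.toCP (ρ : A →⋆ₐ[ℂ] B) : CompletelyPositiveMap A B where
  toLinearMap := (ρ : A →ₗ[ℂ] B)
  map_cstarMatrix_nonneg' k M hM :=
    CompletelyPositiveMapClass.map_cstarMatrix_nonneg' ρ k M hM

theorem StarAlgHom.toCP_apply (ρ : A →⋆ₐ[ℂ] B) (a : A) : ρ.toCP a = ρ a := rfl

/-- A decomposition into four positive elements, each of norm at most `‖a‖`, reduces the bound to
positive elements. The factor `4` is crude, but any uniform constant serves the density arguments.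
-/
theorem CompletelyPositiveMap.norm_apply_le (φ : CompletelyPositiveMap A B) (a : A) :
    ‖φ a‖ ≤ 4 * (‖φ 1‖ * ‖a‖) := by
  obtain ⟨y, hy0, hyn, hy⟩ := CStarAlgebra.exists_sum_four_nonneg a
  conv_lhs => rw [hy]
  simp only [map_sum, map_smul]
  refine (norm_sum_le _ _).trans ?_
  have : ∀ i ∈ Finset.univ, ‖(Complex.I ^ (i : Fin 4).val) • φ (y i)‖ ≤ ‖φ 1‖ * ‖a‖ := fun i _ => by
    rw [norm_smul, norm_pow, Complex.norm_I, one_pow, one_mul]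
    exact ((PositiveLinearMap.norm_apply_le_of_nonneg (.ofClass φ) _ (hy0 i))).trans
      (mul_le_mul_of_nonneg_left (hyn i) (norm_nonneg _))
  refine (Finset.sum_le_sum this).trans ?_
  simp

theorem CompletelyPositiveMap.norm_apply_le_of_map_one (φ : CompletelyPositiveMap A B)
    (hφ : φ 1 = 1) (a : A) : ‖φ a‖ ≤ 4 * ‖a‖ := by
  have h1 : ‖(1 : B)‖ ≤ 1 := by
    rcases subsingleton_or_nontrivial B with h | h
    · simp [Subsingleton.elim (1 : B) 0]
    · exact CStarRing.norm_one.le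
  have := φ.norm_apply_le a
  rw [hφ] at this
  nlinarith [norm_nonneg a]

/-- The standard representation of `M_n(ℂ)` on `ℂⁿ`. -/
def CStarMatrix.stdRep (n : Type*) [Fintype n] [DecidableEq n] :
    CStarMatrix n n ℂ →⋆ₐ[ℂ] (EuclideanSpace ℂ n →L[ℂ] EuclideanSpace ℂ n) where
  toFun M := Matrix.toEuclideanCLM (𝕜 := ℂ) (ofMatrix.symm M)
  map_one' := map_one (Matrix.toEuclideanCLM (n := n) (𝕜 := ℂ))
  map_mul' := map_mul (Matrix.toEuclideanCLM (n := n) (𝕜 := ℂ))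
  map_zero' := map_zero (Matrix.toEuclideanCLM (n := n) (𝕜 := ℂ))
  map_add' := map_add (Matrix.toEuclideanCLM (n := n) (𝕜 := ℂ))
  commutes' r := AlgHomClass.commutes (Matrix.toEuclideanCLM (n := n) (𝕜 := ℂ)) r
  map_star' := map_star (Matrix.toEuclideanCLM (n := n) (𝕜 := ℂ))

theorem CStarMatrix.stdRep_injective (n : Type*) [Fintype n] [DecidableEq n] :
    Function.Injective (stdRep n) :=
  (Matrix.toEuclideanCLM (n := n) (𝕜 := ℂ)).injective

theorem CStarMatrix.inner_stdRep {n : Type*} [Fintype n] [DecidableEq n] (M : CStarMatrix n n ℂ)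
    (x y : EuclideanSpace ℂ n) :
    inner ℂ x (stdRep n M y) = ∑ i, ∑ j, star (x i) * M i j * y j := by
  change inner ℂ x (Matrix.toEuclideanCLM (𝕜 := ℂ) (ofMatrix.symm M) y) = _
  simp [PiLp.inner_apply, Matrix.ofLp_toEuclideanCLM, Matrix.mulVec, dotProduct, Finset.mul_sum,
    mul_assoc, mul_comm, mul_left_comm]

/-- The completely positive map `a ↦ ∑ m, (⟨w m j, a (w m k)⟩)_{j k}` into a matrix algebra. -/
def CompletelyPositiveMap.ofVectors {H : Type*} [NormedAddCommGroup H] [InnerProductSpace ℂ H]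
    [CompleteSpace H] (ρ : A →⋆ₐ[ℂ] (H →L[ℂ] H)) {ι n : Type*} [Fintype ι] [Fintype n]
    [DecidableEq n] (w : ι → n → H) : CompletelyPositiveMap A (CStarMatrix n n ℂ) where
  toFun a := ofMatrix (Matrix.of fun j k => ∑ m, inner ℂ (w m j) (ρ a (w m k)))
  map_add' a b := by
    ext j k
    simp [Finset.sum_add_distrib]
  map_smul' c a := by
    ext j k
    simp [Finset.mul_sum]
  map_cstarMatrix_nonneg' d M hM := by
    have hsa := (IsSelfAdjoint.of_nonneg hM).star_eq
    refine nonneg_of_forall_inner (stdRep n) (stdRep_injective n) ?_ fun η => ?_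
    · ext p q j k
      have h : M p q = star (M q p) := by rw [← star_apply, hsa]
      simp [star_apply, h, map_star, ContinuousLinearMap.star_eq_adjoint,
        ContinuousLinearMap.adjoint_inner_right]
    -- Absorbing the coordinates of `η p` into the vectors `∑ j, η p j • w m j` turns the form into
    -- a sum over `m` of forms of the positive matrix `M`.
    · have : ∑ p, ∑ q, inner ℂ (η p) (stdRep n (ofMatrix (Matrix.of fun j k =>
            ∑ m, inner ℂ (w m j) (ρ (M p q) (w m k)))) (η q)) =
          ∑ m, ∑ p, ∑ q, inner ℂ (∑ j, η p j • w m j) (ρ (M p q) (∑ k, η q k • w m k)) := by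
        simp only [inner_stdRep, map_sum, map_smul, inner_sum, sum_inner, inner_smul_left,
          inner_smul_right, ofMatrix_apply, Matrix.of_apply, Finset.mul_sum, Finset.sum_mul]
        conv_rhs => rw [Finset.sum_comm]; enter [2, p]; rw [Finset.sum_comm]
        refine Finset.sum_congr rfl fun p _ => Finset.sum_congr rfl fun q _ => ?_
        conv_rhs => enter [2, m]; rw [Finset.sum_comm]
        conv_rhs => rw [Finset.sum_comm]; enter [2, i]; rw [Finset.sum_comm]
        refine Finset.sum_congr rfl fun i _ => Finset.sum_congr rfl fun j _ =>
          Finset.sum_congr rfl fun m _ => ?_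
        simp only [RCLike.star_def]
        ring
      refine le_of_le_of_eq ?_ (congrArg Complex.re this.symm)
      rw [Complex.re_sum]
      exact Finset.sum_nonneg fun m _ => re_sum_inner_nonneg ρ hM _

/-- The completely positive map `b ↦ ∑ j k, b j k • R j (R k)⋆` on a matrix algebra. -/
def CompletelyPositiveMap.ofRow {n : Type*} [Fintype n] [DecidableEq n] (R : n → B) :
    CompletelyPositiveMap (CStarMatrix n n ℂ) B where
  toFun b := ∑ j, ∑ k, b j k • (R j * star (R k))
  map_add' a b := by
    simp [add_smul, Finset.sum_add_distrib]
  map_smul' c a := by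
    simp [Finset.smul_sum, smul_smul]
  map_cstarMatrix_nonneg' d M hM := by
    obtain ⟨C, hC⟩ := exists_apply_eq_sum_star_mul hM
    have : M.map (fun b : CStarMatrix n n ℂ => ∑ j, ∑ k, b j k • (R j * star (R k))) =
        ∑ l, ∑ m, ofMatrix (Matrix.of fun p q =>
          star (∑ j, C l p m j • star (R j)) * (∑ k, C l q m k • star (R k))) := by
      ext p q
      rw [map_apply, hC]
      simp only [CStarMatrix.sum_apply, mul_apply, star_apply, ofMatrix_apply, Matrix.of_apply, star_sum,
        star_smul, star_star, Finset.sum_mul, Finset.mul_sum, Finset.sum_smul, smul_mul_assoc,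
        mul_smul_comm, Finset.smul_sum]
      conv_lhs => enter [2, j]; rw [Finset.sum_comm]; enter [2, l]; rw [Finset.sum_comm]
      conv_lhs => rw [Finset.sum_comm]; enter [2, l]; rw [Finset.sum_comm]
      refine Finset.sum_congr rfl fun l _ => Finset.sum_congr rfl fun m _ => ?_
      rw [Finset.sum_comm]
      refine Finset.sum_congr rfl fun k _ => Finset.sum_congr rfl fun j _ => ?_
      rw [smul_smul, mul_comm]
    refine le_of_le_of_eq ?_ this.symm
    exact Finset.sum_nonneg fun l _ => Finset.sum_nonneg fun m _ => star_mul_nonneg _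

end CP

/-! ### Permanence of nuclearity and exactness; the inclusion of the reduced algebra in the Roe
algebra -/

section Nuclear

variable {A : Type u} [CStarAlgebra A] [PartialOrder A] [StarOrderedRing A]

theorem IsNuclearMap.comp_starAlgHom {B : Type*} {C : Type*}
    [CStarAlgebra B] [PartialOrder B] [StarOrderedRing B]
    [CStarAlgebra C] [PartialOrder C] [StarOrderedRing C]
    {θ : B →ₗ[ℂ] C} (hθ : IsNuclearMap θ) (ρ : A →⋆ₐ[ℂ] B) :
    IsNuclearMap (θ ∘ₗ (ρ : A →ₗ[ℂ] B)) := by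
  classical
  intro F ε hε
  obtain ⟨n, φ, ψ, hφ, hψ, h⟩ := hθ (F.image ρ) ε hε
  refine ⟨n, φ.comp ρ.toCP, ψ, ?_, hψ, fun a ha => h _ (Finset.mem_image_of_mem _ ha)⟩
  rw [CompletelyPositiveMap.comp_apply, StarAlgHom.toCP_apply, map_one, hφ]

theorem IsNuclearAlgebra.isNuclearMap (hA : IsNuclearAlgebra A) {B : Type*}
    [CStarAlgebra B] [PartialOrder B] [StarOrderedRing B] (ρ : A →⋆ₐ[ℂ] B) :
    IsNuclearMap (ρ : A →ₗ[ℂ] B) := by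
  intro F ε hε
  obtain ⟨n, φ, ψ, hφ, hψ, h⟩ := hA F ε hε
  refine ⟨n, φ, ρ.toCP.comp ψ, hφ, ?_, fun a ha => ?_⟩
  · rw [CompletelyPositiveMap.comp_apply, StarAlgHom.toCP_apply, hψ, map_one]
  · rw [CompletelyPositiveMap.comp_apply, StarAlgHom.toCP_apply]
    have : (ρ : A →ₗ[ℂ] B) a - ρ (ψ (φ a)) = ρ (a - ψ (φ a)) := by simp
    rw [this]
    exact (NonUnitalStarAlgHom.norm_apply_le ρ _).trans_lt (h a ha)

theorem IsExactAlgebra.of_injective {A B : Type u} [CStarAlgebra A] [PartialOrder A]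
    [StarOrderedRing A] [CStarAlgebra B] [PartialOrder B] [StarOrderedRing B]
    (hB : IsExactAlgebra B) (ρ : A →⋆ₐ[ℂ] B) (hρ : Function.Injective ρ) : IsExactAlgebra A := by
  obtain ⟨H, _, _, _, π, hπ, h⟩ := hB
  exact ⟨H, _, _, _, π.comp ρ, hπ.comp hρ, h.comp_starAlgHom ρ⟩

end Nuclear

theorem isExactAlgebra_uniformRoeAlgebra_of_isNuclearAlgebra {X : Type u} [MetricSpace X]
    (h : IsNuclearAlgebra (uniformRoeAlgebra X)) : IsExactAlgebra (uniformRoeAlgebra X) :=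
  ⟨ℓ²(X, ℂ), _, _, inferInstance, (uniformRoeAlgebra X).subtype, Subtype.val_injective,
    h.isNuclearMap _⟩

/-- Closed balls of a space of bounded geometry are finite. -/
theorem BoundedGeometry.finite_closedBall {X : Type u} [MetricSpace X]
    (hgeom : BoundedGeometry X) (x : X) (r : ℝ) :
    (Metric.closedBall x r).Finite := by
  obtain ⟨N, hN⟩ := hgeom (|r| + 1) (by positivity)
  refine (Set.encard_lt_top_iff.1 ((hN x).trans (ENat.natCast_lt_top N))).subset ?_
  exact Metric.closedBall_subset_ball (by linarith [le_abs_self r])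

section Group

variable {G : Type u} [Group G]

@[simp]
theorem leftRegular_apply (g : G) (f : ℓ²(G, ℂ)) (x : G) :
    leftRegular G g f x = f (g⁻¹ * x) := rfl

theorem deltaVec_apply {X : Type u} [DecidableEq X] (x y : X) :
    deltaVec x y = if y = x then (1 : ℂ) else 0 := by
  have : deltaVec x = lp.single 2 x (1 : ℂ) := by
    unfold deltaVec
    congr!
  rw [this, lp.single_apply]
  split_ifs with h
  · subst h; simp
  · simp [h]

theorem leftRegular_mem_reducedGroupAlgebra (g : G) : leftRegular G g ∈ reducedGroupAlgebra G :=
  StarSubalgebra.le_topologicalClosure _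
    ((AlgHom.mem_range _).2 ⟨MonoidAlgebra.of ℂ G g, MonoidAlgebra.lift_of _ _⟩)

variable [MetricSpace G]

theorem RightInvariantDist.dist_mul_inv (hinv : RightInvariantDist G) (x y : G) :
    dist (x * y⁻¹) 1 = dist x y := by
  rw [← hinv y, inv_mul_cancel_right, one_mul]

/-- Right invariance makes left translation by `g` move every point by the same distance `dist g 1`.
-/
theorem leftRegular_mem_finitePropagationAlgebra (hinv : RightInvariantDist G) (g : G) :
    leftRegular G g ∈ finitePropagationAlgebra G := by
  classical
  refine ⟨dist g 1, dist_nonneg, fun x y hxy => ?_⟩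
  rw [inner_deltaVec, leftRegular_apply, deltaVec_apply, if_neg]
  rintro rfl
  apply hxy.ne
  rw [← hinv.dist_mul_inv x]
  simp

theorem reducedGroupAlgebra_le_uniformRoeAlgebra (hinv : RightInvariantDist G) :
    reducedGroupAlgebra G ≤ uniformRoeAlgebra G := by
  refine StarSubalgebra.topologicalClosure_mono ?_
  rintro _ ⟨a, rfl⟩
  change MonoidAlgebra.lift ℂ _ G (leftRegular G) a ∈ finitePropagationAlgebra G
  rw [MonoidAlgebra.lift_apply, Finsupp.sum]
  exact sum_mem fun g _ =>
    SMulMemClass.smul_mem _ (leftRegular_mem_finitePropagationAlgebra hinv g)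

theorem isExactAlgebra_reducedGroupAlgebra (hinv : RightInvariantDist G)
    (h : IsExactAlgebra (uniformRoeAlgebra G)) : IsExactAlgebra (reducedGroupAlgebra G) :=
  h.of_injective (StarSubalgebra.inclusion (reducedGroupAlgebra_le_uniformRoeAlgebra hinv))
    (StarSubalgebra.inclusion_injective _)

end Group

/-! ### Weighted translations and finite propagation operators -/

section WeightedTranslation

variable {G : Type u}

theorem norm_le_of_forall_norm_apply_le {C : ℝ} (hC : 0 ≤ C) {f f' : ℓ²(G, ℂ)}
    (h : ∀ x, ‖f' x‖ ≤ C * ‖f x‖) : ‖f'‖ ≤ C * ‖f‖ := by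
  refine lp.norm_le_of_tsum_le (by norm_num) (by positivity) ?_
  have hs := (lp.hasSum_norm (p := 2) (by norm_num) f)
  have hs' := (lp.hasSum_norm (p := 2) (by norm_num) f')
  norm_num at hs hs' ⊢
  rw [mul_pow, hs'.tsum_eq, ← hs.tsum_eq, ← tsum_mul_left, ← hs'.tsum_eq]
  refine hs'.summable.tsum_le_tsum (fun x => ?_) (hs.summable.mul_left _)
  rw [← mul_pow]
  exact pow_le_pow_left₀ (norm_nonneg _) (h x) 2

/-- Multiplication by a bounded function on `ℓ²(G)`. -/
def diagOp (c : G → ℂ) (C : ℝ) (hc : ∀ x, ‖c x‖ ≤ C) : ℓ²(G, ℂ) →L[ℂ] ℓ²(G, ℂ) :=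
  LinearMap.mkContinuous
    { toFun := fun f => ⟨fun x => c x * f x, ((lp.memℓp f).const_smul ((|C| : ℝ) : ℂ)).mono' (fun x => by
        simpa using mul_le_mul_of_nonneg_right ((hc x).trans (le_abs_self C)) (norm_nonneg _))⟩
      map_add' := fun f f' => by ext x; exact mul_add _ _ _
      map_smul' := fun a f => by ext x; simp [mul_left_comm] } |C| fun f =>
    norm_le_of_forall_norm_apply_le (abs_nonneg C) fun x => by
        simpa using mul_le_mul_of_nonneg_right ((hc x).trans (le_abs_self C)) (norm_nonneg _)

theorem diagOp_apply (c : G → ℂ) (C : ℝ) (hc : ∀ x, ‖c x‖ ≤ C) (f : ℓ²(G, ℂ)) (x : G) :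
    diagOp c C hc f x = c x * f x := rfl

theorem star_diagOp (c : G → ℂ) (C : ℝ) (hc : ∀ x, ‖c x‖ ≤ C) :
    star (diagOp c C hc) = diagOp (fun x => star (c x)) C (fun x => by simpa using hc x) := by
  rw [ContinuousLinearMap.star_eq_adjoint, eq_comm, ContinuousLinearMap.eq_adjoint_iff]
  intro f f'
  simp only [lp.inner_eq_tsum, diagOp_apply]
  refine tsum_congr fun x => ?_
  simp [mul_comm, mul_left_comm, mul_assoc]

/-- Two operators on `ℓ²` with the same matrix entries are equal. -/
theorem ext_deltaVec {T T' : ℓ²(G, ℂ) →L[ℂ] ℓ²(G, ℂ)}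
    (h : ∀ x, T (deltaVec x) = T' (deltaVec x)) : T = T' := by
  classical
  ext1 f
  have hf := lp.hasSum_single (p := 2) (E := fun _ : G => ℂ) (by norm_num) f
  have hs : ∀ x, lp.single 2 x (f x) = f x • deltaVec x := fun x => by
    ext y
    rw [lp.coeFn_smul, Pi.smul_apply, deltaVec_apply, lp.single_apply]
    split_ifs with h
    · subst h; simp
    · simp [h]
  refine (hf.mapL T).unique ?_
  convert hf.mapL T' using 2 with x
  rw [hs, map_smul, map_smul, h]

theorem norm_deltaVec (x : G) : ‖deltaVec x‖ = 1 := by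
  classical
  unfold deltaVec
  rw [lp.norm_single (by norm_num), norm_one]

theorem norm_inner_deltaVec_le (T : ℓ²(G, ℂ) →L[ℂ] ℓ²(G, ℂ)) (x y : G) :
    ‖inner ℂ (deltaVec x) (T (deltaVec y))‖ ≤ ‖T‖ := by
  refine (norm_inner_le_norm _ _).trans ?_
  rw [norm_deltaVec, one_mul]
  exact (T.le_opNorm _).trans (by rw [norm_deltaVec, mul_one])

section Diag

variable [MetricSpace G]

theorem diagOp_mem_finitePropagationAlgebra (c : G → ℂ) (C : ℝ) (hc : ∀ x, ‖c x‖ ≤ C) :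
    diagOp c C hc ∈ finitePropagationAlgebra G := by
  classical
  refine ⟨0, le_rfl, fun x y hxy => ?_⟩
  rw [inner_deltaVec, diagOp_apply, deltaVec_apply, if_neg (dist_pos.1 hxy), mul_zero]

end Diag

variable [Group G]

/-- The weighted translation `f ↦ (x ↦ c x * f (s⁻¹ x))`. -/
def weightedTranslation (c : G → ℂ) (C : ℝ) (hc : ∀ x, ‖c x‖ ≤ C) (s : G) :
    ℓ²(G, ℂ) →L[ℂ] ℓ²(G, ℂ) :=
  diagOp c C hc * leftRegular G s

theorem weightedTranslation_apply (c : G → ℂ) (C : ℝ) (hc : ∀ x, ‖c x‖ ≤ C) (s : G)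
    (f : ℓ²(G, ℂ)) (x : G) : weightedTranslation c C hc s f x = c x * f (s⁻¹ * x) := rfl

theorem star_weightedTranslation_apply (c : G → ℂ) (C : ℝ) (hc : ∀ x, ‖c x‖ ≤ C) (s : G)
    (f : ℓ²(G, ℂ)) (x : G) :
    star (weightedTranslation c C hc s) f x = star (c (s * x)) * f (s * x) := by
  rw [weightedTranslation, star_mul, star_diagOp, star_leftRegular, mul_apply_eq_comp,
    leftRegular_apply, diagOp_apply, inv_inv]

variable [MetricSpace G]

theorem weightedTranslation_mem (hinv : RightInvariantDist G) (c : G → ℂ) (C : ℝ)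
    (hc : ∀ x, ‖c x‖ ≤ C) (s : G) : weightedTranslation c C hc s ∈ uniformRoeAlgebra G :=
  StarSubalgebra.le_topologicalClosure _ (mul_mem (diagOp_mem_finitePropagationAlgebra c C hc)
    (leftRegular_mem_finitePropagationAlgebra hinv s))

/-- A finite propagation operator is a finite sum of weighted translations. -/
theorem FinitePropagation.exists_eq_sum (hinv : RightInvariantDist G) (hgeom : BoundedGeometry G)
    {T : ℓ²(G, ℂ) →L[ℂ] ℓ²(G, ℂ)} (hT : FinitePropagation T) : ∃ s : Finset G,
      T = ∑ g ∈ s, weightedTranslation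
        (fun x => inner ℂ (deltaVec x) (T (deltaVec (g⁻¹ * x)))) ‖T‖
        (fun _ => norm_inner_deltaVec_le T _ _) g := by
  classical
  obtain ⟨S, _, hS⟩ := hT
  -- The entry at `(x, y)` belongs to the single translation by `x * y⁻¹`, and it vanishes unless
  -- this element lies in the ball of radius `S`, which is finite.
  refine ⟨(hgeom.finite_closedBall 1 S).toFinset, ext_deltaVec fun y => ?_⟩
  ext x
  rw [sum_apply, lp.coeFn_sum, Finset.sum_apply]
  simp only [weightedTranslation_apply, deltaVec_apply, mul_ite, mul_one, mul_zero]
  rw [Finset.sum_congr rfl (g := fun g => if x * y⁻¹ = g then T (deltaVec y) x else 0),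
    Finset.sum_ite_eq]
  · split_ifs with h
    · rfl
    · rw [← inner_deltaVec, hS]
      simpa [hinv.dist_mul_inv] using h
  · intro g _
    have : g⁻¹ * x = y ↔ x * y⁻¹ = g := by
      constructor <;> rintro rfl <;> simp
    simp only [this]
    split_ifs with h
    · rw [inner_deltaVec, this.2 h]
    · rfl

end WeightedTranslation

/-! ### Property A implies nuclearity of the uniform Roe algebra -/

/-- A bounded function into a finite dimensional space is, up to a small error, constant on the
classes of a finite partition. -/
theorem exists_finite_partition {X : Type*} {K : Type*} [Fintype K] (Φ : X → K → ℂ) {C : ℝ}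
    (hΦ : ∀ z k, ‖Φ z k‖ ≤ C) {ε : ℝ} (hε : 0 < ε) :
    ∃ (n : ℕ) (cl : X → Fin n) (rep : Fin n → X),
      ∀ z k, ‖Φ (rep (cl z)) k - Φ z k‖ ≤ ε := by
  have hb : Bornology.IsBounded (Set.range Φ) := by
    refine isBounded_iff_forall_norm_le.2 ⟨max C 0, ?_⟩
    rintro _ ⟨z, rfl⟩
    exact (pi_norm_le_iff_of_nonneg (le_max_right _ _)).2 fun k => (hΦ z k).trans (le_max_left _ _)
  -- The centres of the finite net are taken in the range of `Φ`, so that each is the value at some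
  -- representative point.
  obtain ⟨t, hts, htf, ht⟩ := totallyBounded_iff_subset.1
    (hb.isCompact_closure.totallyBounded.subset subset_closure) _
    (Metric.dist_mem_uniformity hε)
  have := htf.fintype
  let e := Fintype.equivFin t
  have hrep : ∀ y : t, ∃ x, Φ x = y := fun y => hts y.2
  choose rep hrep using hrep
  have hcl : ∀ z, ∃ y : t, dist (Φ z) y < ε := fun z => by
    have := ht ⟨z, rfl⟩
    simp only [Set.mem_iUnion] at this
    obtain ⟨y, hy, h⟩ := this
    exact ⟨⟨y, hy⟩, h⟩
  choose cl hcl using hcl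
  refine ⟨_, fun z => e (cl z), fun i => rep (e.symm i), fun z k => ?_⟩
  beta_reduce
  rw [e.symm_apply_apply, hrep, ← dist_eq_norm, dist_comm]
  exact (dist_le_pi_dist _ _ k).trans (hcl z).le

/-- Unit vectors with small support and slow variation on a space with property A. -/
theorem PropertyA.exists_vectors {X : Type u} [MetricSpace X] (hA : PropertyA X) {R δ : ℝ}
    (hR : 0 < R) (hδ : 0 < δ) : ∃ (ξ : X → X → ℝ) (S : ℝ),
      (∀ x z, 0 ≤ ξ x z) ∧ (∀ x z, ξ x z ≠ 0 → dist x z ≤ S) ∧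
      (∀ x (Z : Finset X), ∑ z ∈ Z, ξ x z ^ 2 ≤ 1) ∧
      (∀ x (Z : Finset X), (∀ z, ξ x z ≠ 0 → z ∈ Z) → ∑ z ∈ Z, ξ x z ^ 2 = 1) ∧
      ∀ x y (Z : Finset X), dist x y ≤ R → (∀ z, ξ x z ≠ 0 → z ∈ Z) →
        1 - δ ≤ ∑ z ∈ Z, ξ x z * ξ y z := by
  classical
  obtain ⟨A, hne, hlt, S, hS⟩ := hA R δ hR hδ
  have hlt' : ∀ x y, dist x y ≤ R →
      ((symmDiff (A x) (A y)).card : ℝ) < δ * ((A x ∩ A y).card : ℝ) := fun x y h => by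
    convert hlt x y h
  let a : X → X → ℕ := fun x z => ((A x).filter (·.1 = z)).card
  have hcard : ∀ x, (0 : ℝ) < (A x).card := fun x => by exact_mod_cast (hne x).card_pos
  have ha_mem : ∀ x z, a x z ≠ 0 → ∃ p ∈ A x, p.1 = z := fun x z h => by
    obtain ⟨p, hp⟩ := Finset.card_pos.1 (Nat.pos_of_ne_zero h)
    exact ⟨p, (Finset.mem_filter.1 hp).1, (Finset.mem_filter.1 hp).2⟩
  have hmem_a : ∀ x, ∀ p ∈ A x, a x p.1 ≠ 0 := fun x p hp =>
    (Finset.card_pos (s := (A x).filter (·.1 = p.1))).2 ⟨p, Finset.mem_filter.2 ⟨hp, rfl⟩⟩ |>.ne'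
  -- The square of `ξ x` is the distribution on `X` of the first coordinate of a uniformly chosen
  -- point of `A x`.
  let ξ : X → X → ℝ := fun x z => √(a x z / (A x).card)
  have hξ0 : ∀ x z, ξ x z ≠ 0 ↔ a x z ≠ 0 := fun x z => by
    have := (hcard x).ne'
    rw [ne_eq, Real.sqrt_eq_zero (by positivity), div_eq_zero_iff]
    simp [this] at *
  have hξsq : ∀ x z, ξ x z ^ 2 = a x z / (A x).card := fun x z => Real.sq_sqrt (by positivity)
  have hsum : ∀ x (Z : Finset X), (∀ z, ξ x z ≠ 0 → z ∈ Z) → ∑ z ∈ Z, ξ x z ^ 2 = 1 := by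
    intro x Z hZ
    simp only [hξsq]
    rw [← Finset.sum_div, div_eq_one_iff_eq (hcard x).ne', ← Nat.cast_sum, Nat.cast_inj, eq_comm]
    exact Finset.card_eq_sum_card_fiberwise fun p hp => hZ _ ((hξ0 _ _).2 (hmem_a x p hp))
  refine ⟨ξ, S, fun x z => Real.sqrt_nonneg _, fun x z h => ?_, fun x Z => ?_, hsum,
    fun x y Z hxy hZ => ?_⟩
  · obtain ⟨p, hp, rfl⟩ := ha_mem x z ((hξ0 x z).1 h)
    exact hS x p hp
  · rw [← hsum x (Z ∪ (A x).image Prod.fst) fun z hz => ?_]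
    · exact Finset.sum_le_sum_of_subset_of_nonneg Finset.subset_union_left
        fun _ _ _ => sq_nonneg _
    · obtain ⟨p, hp, rfl⟩ := ha_mem x z ((hξ0 x z).1 hz)
      exact Finset.mem_union_right _ (Finset.mem_image_of_mem _ hp)
  · set I := A x ∩ A y
    -- `M` is the size of `A x ∪ A y` and dominates both cardinalities, so each product `ξ x z * ξ y
    -- z` is at least the number of points of `I` over `z`, divided by `M`. The total `|I| / M` is
    -- at least `1 - δ` because `M - |I| < δ |I| ≤ δ M`.
    set M : ℝ := I.card + (symmDiff (A x) (A y)).card with hM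
    have hxM : ((A x).card : ℝ) ≤ M := by
      rw [hM]
      exact_mod_cast (Finset.card_le_card (t := I ∪ symmDiff (A x) (A y)) fun p hp => by
        by_cases h : p ∈ A y <;> simp [I, Finset.mem_symmDiff, hp, h]).trans
          (Finset.card_union_le _ _)
    have hyM : ((A y).card : ℝ) ≤ M := by
      rw [hM]
      exact_mod_cast (Finset.card_le_card (t := I ∪ symmDiff (A x) (A y)) fun p hp => by
        by_cases h : p ∈ A x <;> simp [I, Finset.mem_symmDiff, hp, h]).trans
          (Finset.card_union_le _ _)
    have hM0 : 0 < M := (hcard x).trans_le hxM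
    have hIc : (I.card : ℝ) = ∑ z ∈ Z, ((I.filter (·.1 = z)).card : ℝ) := by
      rw [← Nat.cast_sum, Nat.cast_inj]
      exact Finset.card_eq_sum_card_fiberwise fun p hp =>
        hZ _ ((hξ0 _ _).2 (hmem_a x p (Finset.mem_inter.1 hp).1))
    have h1 : (I.card : ℝ) / M ≤ ∑ z ∈ Z, ξ x z * ξ y z := by
      rw [hIc, Finset.sum_div]
      refine Finset.sum_le_sum fun z _ => ?_
      set c : ℝ := ((I.filter (·.1 = z)).card : ℝ)
      have hcx : c ≤ a x z := Nat.cast_le.2 <|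
        Finset.card_le_card (Finset.filter_subset_filter _ Finset.inter_subset_left)
      have hcy : c ≤ a y z := Nat.cast_le.2 <|
        Finset.card_le_card (Finset.filter_subset_filter _ Finset.inter_subset_right)
      rw [← Real.mul_self_sqrt (show 0 ≤ c / M by positivity)]
      have := hcard x
      have := hcard y
      gcongr <;> exact Real.sqrt_le_sqrt (by gcongr)
    refine le_trans ?_ h1
    rw [le_div_iff₀ hM0]
    have := hlt' x y hxy
    have hle : (I.card : ℝ) ≤ M := by rw [hM]; simp
    nlinarith

section Factorization

variable {A : Type u} [CStarAlgebra A] [PartialOrder A] [StarOrderedRing A]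

/-- Nuclearity may be tested with matrix algebras indexed by arbitrary finite types. -/
theorem isNuclearAlgebra_of_fintype
    (h : ∀ (F : Finset A) (ε : ℝ), 0 < ε → ∃ (J : Type u) (_ : Fintype J) (_ : DecidableEq J)
      (φ : CompletelyPositiveMap A (CStarMatrix J J ℂ))
      (ψ : CompletelyPositiveMap (CStarMatrix J J ℂ) A),
      φ 1 = 1 ∧ ψ 1 = 1 ∧ ∀ a ∈ F, ‖a - ψ (φ a)‖ < ε) : IsNuclearAlgebra A := by
  intro F ε hε
  obtain ⟨J, _, _, φ, ψ, hφ, hψ, h⟩ := h F ε hε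
  let e := CStarMatrix.reindexₐ ℂ ℂ (Fintype.equivFin J)
  let e₁ : CStarMatrix J J ℂ →⋆ₐ[ℂ] CStarMatrix (Fin _) (Fin _) ℂ := StarAlgEquiv.toStarAlgHom e
  let e₂ : CStarMatrix (Fin _) (Fin _) ℂ →⋆ₐ[ℂ] CStarMatrix J J ℂ := StarAlgEquiv.toStarAlgHom e.symm
  refine ⟨_, e₁.toCP.comp φ, ψ.comp e₂.toCP, ?_, ?_, fun a ha => ?_⟩
  · rw [CompletelyPositiveMap.comp_apply, StarAlgHom.toCP_apply, hφ, map_one]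
  · rw [CompletelyPositiveMap.comp_apply, StarAlgHom.toCP_apply, map_one, hψ]
  · convert h a ha using 2
    simp only [CompletelyPositiveMap.comp_apply, StarAlgHom.toCP_apply]
    congr 2
    exact e.symm_apply_apply _

/-- Each of `φ` and `ψ` has norm at most `4`, so replacing `a` by the sum costs at most `(1 + 16) ε
/ 60`; adding the `ε / 3` from the sum itself stays below `ε`. -/
theorem norm_sub_factorization_lt {n : Type*} [Fintype n] [DecidableEq n]
    {φ : CompletelyPositiveMap A (CStarMatrix n n ℂ)}
    {ψ : CompletelyPositiveMap (CStarMatrix n n ℂ) A} (hφ : φ 1 = 1) (hψ : ψ 1 = 1)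
    {ι : Type*} {s : Finset ι} {W : ι → A} {c ε : ℝ} (hW : ∀ i ∈ s, ‖W i - ψ (φ (W i))‖ ≤ c)
    (hc : s.card * c ≤ ε / 3) {a : A} (ha : ‖a - ∑ i ∈ s, W i‖ < ε / 60) :
    ‖a - ψ (φ a)‖ < ε := by
  set T := ∑ i ∈ s, W i with hT
  have hmid : ‖T - ψ (φ T)‖ ≤ ε / 3 := by
    have h1 : T - ψ (φ T) = ∑ i ∈ s, (W i - ψ (φ (W i))) := by
      rw [Finset.sum_sub_distrib, ← map_sum, ← map_sum]
    rw [h1]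
    refine (norm_sum_le _ _).trans ((Finset.sum_le_sum hW).trans ?_)
    rwa [Finset.sum_const, nsmul_eq_mul]
  have hlast : ‖ψ (φ (a - T))‖ ≤ 16 * ‖a - T‖ := by
    linarith [φ.norm_apply_le_of_map_one hφ (a - T), ψ.norm_apply_le_of_map_one hψ (φ (a - T))]
  have htri : a - ψ (φ a) = (a - T) + (T - ψ (φ T)) - ψ (φ (a - T)) := by
    rw [map_sub, map_sub]
    abel
  rw [htri]
  have h3 := norm_sub_le ((a - T) + (T - ψ (φ T))) (ψ (φ (a - T)))
  have h4 := norm_add_le (a - T) (T - ψ (φ T))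
  linarith [norm_nonneg (a - T)]

end Factorization

section RoeFactorization

variable {G : Type u} [Group G] {n : ℕ}

open Classical in
/-- The coefficients of the row `roeRow`. -/
def rowWeight (ξ : G → G → ℝ) (cl : G → Fin n) (i : Fin n) (g x : G) : ℂ :=
  if cl (g⁻¹ * x) = i then (ξ x (g⁻¹ * x) : ℂ) else 0

theorem norm_rowWeight_le {ξ : G → G → ℝ} (hξ : ∀ x z, |ξ x z| ≤ 1) (cl : G → Fin n) (i : Fin n)
    (g x : G) : ‖rowWeight ξ cl i g x‖ ≤ 1 := by
  unfold rowWeight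
  split_ifs
  · simpa using hξ _ _
  · simp

variable [MetricSpace G]

/-- The row of weighted translations that defines the map from matrices to the uniform Roe
algebra. -/
def roeRow (hinv : RightInvariantDist G) {ξ : G → G → ℝ} (hξ : ∀ x z, |ξ x z| ≤ 1)
    (cl : G → Fin n) (E : Finset G) (j : Fin n × E) : uniformRoeAlgebra G :=
  ⟨weightedTranslation (rowWeight ξ cl j.1 j.2) 1 (norm_rowWeight_le hξ cl j.1 j.2) j.2,
    weightedTranslation_mem hinv _ _ _ _⟩

/-- Both factors of the product test the class of the same intermediate point `z = g⁻¹ x`, so only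
the diagonal blocks `i = k` survive. -/
theorem roeRow_mul_star_apply (hinv : RightInvariantDist G) {ξ : G → G → ℝ}
    (hξ : ∀ x z, |ξ x z| ≤ 1) (cl : G → Fin n) (E : Finset G) (i k : Fin n) (g h : E)
    (f : ℓ²(G, ℂ)) (x : G) :
    ((roeRow hinv hξ cl E (i, g) * star (roeRow hinv hξ cl E (k, h)) : uniformRoeAlgebra G) :
      ℓ²(G, ℂ) →L[ℂ] ℓ²(G, ℂ)) f x =
      if cl ((g : G)⁻¹ * x) = i then if cl ((g : G)⁻¹ * x) = k then
        (ξ x ((g : G)⁻¹ * x) * ξ (h * ((g : G)⁻¹ * x)) ((g : G)⁻¹ * x) : ℝ) *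
          f (h * ((g : G)⁻¹ * x)) else 0 else 0 := by
  change (weightedTranslation _ 1 _ (g : G) * star (weightedTranslation _ 1 _ (h : G)) :
    ℓ²(G, ℂ) →L[ℂ] ℓ²(G, ℂ)) f x = _
  rw [mul_apply_eq_comp, weightedTranslation_apply, star_weightedTranslation_apply]
  simp only [rowWeight, inv_mul_cancel_left]
  split_ifs <;> simp [mul_assoc]

variable [DecidableEq G]

theorem ofRow_roeRow_apply (hinv : RightInvariantDist G) {ξ : G → G → ℝ}
    (hξ : ∀ x z, |ξ x z| ≤ 1) (cl : G → Fin n) (E : Finset G)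
    (b : CStarMatrix (Fin n × E) (Fin n × E) ℂ) (f : ℓ²(G, ℂ)) (x : G) :
    (CompletelyPositiveMap.ofRow (roeRow hinv hξ cl E) b : ℓ²(G, ℂ) →L[ℂ] ℓ²(G, ℂ)) f x =
      ∑ g : E, ∑ h : E, b (cl ((g : G)⁻¹ * x), g) (cl ((g : G)⁻¹ * x), h) *
        ((ξ x ((g : G)⁻¹ * x) * ξ (h * ((g : G)⁻¹ * x)) ((g : G)⁻¹ * x) : ℝ) *
          f (h * ((g : G)⁻¹ * x))) := by
  have h1 : (CompletelyPositiveMap.ofRow (roeRow hinv hξ cl E) b : ℓ²(G, ℂ) →L[ℂ] ℓ²(G, ℂ)) =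
      ∑ j, ∑ k, b j k • ((roeRow hinv hξ cl E j * star (roeRow hinv hξ cl E k) :
        uniformRoeAlgebra G) : ℓ²(G, ℂ) →L[ℂ] ℓ²(G, ℂ)) := by
    change ((∑ j, ∑ k, b j k • (roeRow hinv hξ cl E j * star (roeRow hinv hξ cl E k)) :
      uniformRoeAlgebra G) : ℓ²(G, ℂ) →L[ℂ] ℓ²(G, ℂ)) = _
    simp only [AddSubmonoidClass.coe_finsetSum]
    rfl
  rw [h1]
  simp only [sum_apply, lp.coeFn_sum, Finset.sum_apply, smul_apply, lp.coeFn_smul, Pi.smul_apply,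
    Fintype.sum_prod_type, roeRow_mul_star_apply, smul_eq_mul]
  rw [Finset.sum_comm]
  refine Finset.sum_congr rfl fun g _ => ?_
  rw [Finset.sum_eq_single (cl ((g : G)⁻¹ * x)), Finset.sum_comm]
  · refine Finset.sum_congr rfl fun h _ => ?_
    simp
  · intro i _ hi
    simp [hi.symm]
  · simp

/-- The compression to the `E`-neighbourhoods of finitely many points. -/
def roeCompression (rep : Fin n → G) (E : Finset G) :
    CompletelyPositiveMap (uniformRoeAlgebra G) (CStarMatrix (Fin n × E) (Fin n × E) ℂ) :=
  CompletelyPositiveMap.ofVectors (uniformRoeAlgebra G).subtype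
    fun (m : Fin n) (j : Fin n × E) => if j.1 = m then deltaVec (j.2 * rep m) else 0

theorem roeCompression_apply (rep : Fin n → G) (E : Finset G) (T : uniformRoeAlgebra G)
    (i k : Fin n) (g h : E) : roeCompression rep E T (i, g) (k, h) =
      if i = k then (T : ℓ²(G, ℂ) →L[ℂ] ℓ²(G, ℂ)) (deltaVec (h * rep i)) (g * rep i) else 0 := by
  change ∑ m, inner ℂ (if i = m then deltaVec ((g : G) * rep m) else 0)
    ((T : ℓ²(G, ℂ) →L[ℂ] ℓ²(G, ℂ)) (if k = m then deltaVec ((h : G) * rep m) else 0)) = _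
  rw [Finset.sum_eq_single i]
  · by_cases hik : i = k
    · subst hik
      simp [inner_deltaVec]
    · simp [hik, Ne.symm hik]
  · intro m _ hm
    simp [hm.symm]
  · simp

theorem roeCompression_one (rep : Fin n → G) (E : Finset G) : roeCompression rep E 1 = 1 := by
  ext ⟨i, g⟩ ⟨k, h⟩
  rw [roeCompression_apply, CStarMatrix.one_apply]
  change (if i = k then deltaVec ((h : G) * rep i) (g * rep i) else 0) = _
  simp only [deltaVec_apply, mul_left_inj, Prod.mk.injEq]
  by_cases hik : i = k
  · subst hik
    simp only [true_and, if_true]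
    exact if_congr Subtype.ext_iff.symm rfl rfl
  · simp [hik]

/-- The compressed matrix pairs `g` only with `h = s⁻¹ g`, so the image is again a translation by
`s`. If `s⁻¹ g` falls outside `E`, then `ξ (s⁻¹ x)` vanishes at `g⁻¹ x` and nothing is lost by the
truncation. -/
theorem ofRow_roeRow_roeCompression_apply (hinv : RightInvariantDist G) {ξ : G → G → ℝ}
    (hξ : ∀ x z, |ξ x z| ≤ 1) (cl : G → Fin n) (rep : Fin n → G) {S : ℝ}
    (hS : ∀ x z, ξ x z ≠ 0 → dist x z ≤ S) {E : Finset G} (hE : ∀ g, dist g 1 ≤ S → g ∈ E)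
    (t : G → ℂ) (C : ℝ) (ht : ∀ x, ‖t x‖ ≤ C) (s : G) (f : ℓ²(G, ℂ)) (x : G) :
    (CompletelyPositiveMap.ofRow (roeRow hinv hξ cl E) (roeCompression rep E
      ⟨weightedTranslation t C ht s, weightedTranslation_mem hinv t C ht s⟩) :
      ℓ²(G, ℂ) →L[ℂ] ℓ²(G, ℂ)) f x =
      (∑ g ∈ E, t (g * rep (cl (g⁻¹ * x))) * (ξ x (g⁻¹ * x) * ξ (s⁻¹ * x) (g⁻¹ * x) : ℝ)) *
        f (s⁻¹ * x) := by
  rw [ofRow_roeRow_apply, Finset.sum_mul, ← Finset.sum_coe_sort E]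
  refine Finset.sum_congr rfl fun g _ => ?_
  simp only [roeCompression_apply, if_true, weightedTranslation_apply, deltaVec_apply]
  by_cases hg : s⁻¹ * (g : G) ∈ E
  · rw [Finset.sum_eq_single ⟨s⁻¹ * (g : G), hg⟩]
    · simp [mul_assoc]
    · intro h _ hh
      have : s⁻¹ * ((g : G) * rep (cl ((g : G)⁻¹ * x))) ≠ h * rep (cl ((g : G)⁻¹ * x)) := by
        rw [← mul_assoc, ne_eq, mul_left_inj]
        exact fun h' => hh (Subtype.ext h'.symm)
      simp [this]
    · simp
  · have h0 : ξ (s⁻¹ * x) ((g : G)⁻¹ * x) = 0 := by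
      by_contra h
      refine hg (hE _ ?_)
      have := hS _ _ h
      rw [← hinv.dist_mul_inv] at this
      simpa [mul_assoc] using this
    rw [h0, mul_zero, Complex.ofReal_zero, mul_zero, zero_mul]
    refine Finset.sum_eq_zero fun h _ => ?_
    have : s⁻¹ * ((g : G) * rep (cl ((g : G)⁻¹ * x))) ≠ h * rep (cl ((g : G)⁻¹ * x)) := by
      rw [← mul_assoc, ne_eq, mul_left_inj]
      exact fun h' => hg (h' ▸ h.2)
    simp [this]

theorem sum_inv_mul_eq_sum_image {G M : Type*} [Group G] [DecidableEq G] [AddCommMonoid M]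
    (E : Finset G) (x : G) (F : G → M) :
    ∑ g ∈ E, F (g⁻¹ * x) = ∑ z ∈ E.image (fun g => g⁻¹ * x), F z := by
  rw [Finset.sum_image]
  intro a _ b _ h
  simpa using h

theorem mem_image_inv_mul (hinv : RightInvariantDist G) {S : ℝ} {E : Finset G}
    (hE : ∀ g, dist g 1 ≤ S → g ∈ E) {x z : G} (h : dist x z ≤ S) :
    z ∈ E.image (fun g => g⁻¹ * x) :=
  Finset.mem_image.2 ⟨x * z⁻¹, hE _ (by rwa [hinv.dist_mul_inv]), by simp⟩

/-- Only the terms `h = g` remain, and `z = g⁻¹ x` covers the support of `ξ x` as `g` runs over `E`;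
unitality is the normalization of `ξ x`. -/
theorem ofRow_roeRow_one (hinv : RightInvariantDist G) {ξ : G → G → ℝ}
    (hξ : ∀ x z, |ξ x z| ≤ 1) (cl : G → Fin n) {S : ℝ}
    (hS : ∀ x z, ξ x z ≠ 0 → dist x z ≤ S) {E : Finset G} (hE : ∀ g, dist g 1 ≤ S → g ∈ E)
    (hsum : ∀ x (Z : Finset G), (∀ z, ξ x z ≠ 0 → z ∈ Z) → ∑ z ∈ Z, ξ x z ^ 2 = 1) :
    CompletelyPositiveMap.ofRow (roeRow hinv hξ cl E) 1 = 1 := by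
  apply Subtype.ext
  ext f x
  rw [ofRow_roeRow_apply]
  have : ∀ g : E, ∑ h : E, (1 : CStarMatrix (Fin n × E) (Fin n × E) ℂ)
      (cl ((g : G)⁻¹ * x), g) (cl ((g : G)⁻¹ * x), h) *
        ((ξ x ((g : G)⁻¹ * x) * ξ (h * ((g : G)⁻¹ * x)) ((g : G)⁻¹ * x) : ℝ) *
          f (h * ((g : G)⁻¹ * x))) = ((ξ x ((g : G)⁻¹ * x)) ^ 2 : ℝ) * f x := fun g => by
    rw [Finset.sum_eq_single g]
    · simp [sq]
    · intro h _ hh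
      simp [hh.symm]
    · simp
  rw [Finset.sum_congr rfl fun g _ => this g, ← Finset.sum_mul, ← Complex.ofReal_sum,
    Finset.sum_coe_sort E (fun g : G => ξ x (g⁻¹ * x) ^ 2), sum_inv_mul_eq_sum_image E x fun z => ξ x z ^ 2,
    hsum x _ fun z hz => mem_image_inv_mul hinv hE (hS x z hz)]
  simp

theorem norm_weight_sub_le (hinv : RightInvariantDist G) {ξ : G → G → ℝ}
    (hξ0 : ∀ x z, 0 ≤ ξ x z) (cl : G → Fin n) (rep : Fin n → G) {S R δ : ℝ} (hδ : 0 ≤ δ)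
    (hS : ∀ x z, ξ x z ≠ 0 → dist x z ≤ S) {E : Finset G} (hE : ∀ g, dist g 1 ≤ S → g ∈ E)
    (hle : ∀ x (Z : Finset G), ∑ z ∈ Z, ξ x z ^ 2 ≤ 1)
    (hvar : ∀ x y (Z : Finset G), dist x y ≤ R → (∀ z, ξ x z ≠ 0 → z ∈ Z) →
        1 - δ ≤ ∑ z ∈ Z, ξ x z * ξ y z)
    (t : G → ℂ) (C : ℝ) (ht : ∀ x, ‖t x‖ ≤ C)
    (hrep : ∀ g ∈ E, ∀ z, ‖t (g * rep (cl z)) - t (g * z)‖ ≤ δ) (s : G) (hs : dist s 1 ≤ R)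
    (x : G) :
    ‖t x - ∑ g ∈ E, t (g * rep (cl (g⁻¹ * x))) *
      (ξ x (g⁻¹ * x) * ξ (s⁻¹ * x) (g⁻¹ * x) : ℝ)‖ ≤ δ * (1 + C) := by
  set q : G → ℝ := fun z => ξ x z * ξ (s⁻¹ * x) z with hq
  have hq0 : ∀ z, 0 ≤ q z := fun z => mul_nonneg (hξ0 _ _) (hξ0 _ _)
  have hsum : ∑ g ∈ E, q (g⁻¹ * x) = ∑ z ∈ E.image (fun g => g⁻¹ * x), q z :=
    sum_inv_mul_eq_sum_image E x q
  have hlo : 1 - δ ≤ ∑ g ∈ E, q (g⁻¹ * x) := by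
    rw [hsum]
    refine hvar x _ _ ?_ fun z hz => mem_image_inv_mul hinv hE (hS x z hz)
    rw [← hinv.dist_mul_inv]
    simpa using hs
  have hhi : ∑ g ∈ E, q (g⁻¹ * x) ≤ 1 := by
    rw [hsum]
    set Z := E.image (fun g => g⁻¹ * x)
    have : ∑ z ∈ Z, q z ≤ ∑ z ∈ Z, (ξ x z ^ 2 / 2 + ξ (s⁻¹ * x) z ^ 2 / 2) :=
      Finset.sum_le_sum fun z _ => by
        simp only [hq]
        nlinarith [sq_nonneg (ξ x z - ξ (s⁻¹ * x) z)]
    rw [Finset.sum_add_distrib, ← Finset.sum_div, ← Finset.sum_div] at this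
    linarith [hle x Z, hle (s⁻¹ * x) Z]
  -- Since `g * (g⁻¹ * x) = x`, the error splits into the mass missing from `q`, at most `δ` times
  -- `C`, and the cost of replacing points by representatives, at most `δ`.
  have hsplit : t x - ∑ g ∈ E, t (g * rep (cl (g⁻¹ * x))) * (q (g⁻¹ * x) : ℂ) =
      ((1 - ∑ g ∈ E, q (g⁻¹ * x) : ℝ) : ℂ) * t x -
        ∑ g ∈ E, (t (g * rep (cl (g⁻¹ * x))) - t (g * (g⁻¹ * x))) * (q (g⁻¹ * x) : ℂ) := by
    simp only [mul_inv_cancel_left, sub_mul, Finset.sum_sub_distrib, ← Finset.mul_sum]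
    push_cast
    ring
  rw [hsplit]
  refine (norm_sub_le _ _).trans ?_
  have h1 : ‖((1 - ∑ g ∈ E, q (g⁻¹ * x) : ℝ) : ℂ) * t x‖ ≤ δ * C := by
    rw [norm_mul, Complex.norm_real, Real.norm_of_nonneg (by linarith)]
    exact mul_le_mul (by linarith) (ht x) (norm_nonneg _) hδ
  have h2 : ‖∑ g ∈ E, (t (g * rep (cl (g⁻¹ * x))) - t (g * (g⁻¹ * x))) * (q (g⁻¹ * x) : ℂ)‖ ≤
      δ * 1 := by
    refine (norm_sum_le _ _).trans ((Finset.sum_le_sum fun g hg => ?_).trans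
      (le_of_eq_of_le (Finset.mul_sum _ _ _).symm (mul_le_mul_of_nonneg_left hhi hδ)))
    rw [norm_mul, Complex.norm_real, Real.norm_of_nonneg (hq0 _)]
    exact mul_le_mul_of_nonneg_right (hrep g hg _) (hq0 _)
  linarith

/-- On a group with property A, finitely many weighted translations can be approximated by their
images under unital completely positive maps through a matrix algebra. -/
theorem PropertyA.exists_factorization (hinv : RightInvariantDist G) (hgeom : BoundedGeometry G)
    (hA : PropertyA G) {ι : Type*} [Fintype ι] (t : ι → G → ℂ) (C : ι → ℝ)
    (ht : ∀ k x, ‖t k x‖ ≤ C k) (s : ι → G) {δ : ℝ} (hδ : 0 < δ) :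
    ∃ (J : Type u) (_ : Fintype J) (_ : DecidableEq J)
      (φ : CompletelyPositiveMap (uniformRoeAlgebra G) (CStarMatrix J J ℂ))
      (ψ : CompletelyPositiveMap (CStarMatrix J J ℂ) (uniformRoeAlgebra G)),
      φ 1 = 1 ∧ ψ 1 = 1 ∧ ∀ k,
        ‖(⟨weightedTranslation (t k) (C k) (ht k) (s k), weightedTranslation_mem hinv _ _ _ _⟩ :
          uniformRoeAlgebra G) - ψ (φ ⟨weightedTranslation (t k) (C k) (ht k) (s k),
            weightedTranslation_mem hinv _ _ _ _⟩)‖ ≤ δ * (1 + C k) := by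
  have hC : ∀ k, 0 ≤ C k := fun k => (norm_nonneg _).trans (ht k 1)
  obtain ⟨R, hR0, hR⟩ : ∃ R : ℝ, 0 < R ∧ ∀ k, dist (s k) 1 ≤ R := by
    refine ⟨1 + ∑ k, dist (s k) 1, ?_, fun k => ?_⟩
    · have : 0 ≤ ∑ k, dist (s k) 1 := Finset.sum_nonneg fun _ _ => dist_nonneg
      linarith
    · have := Finset.single_le_sum (f := fun k => dist (s k) 1) (fun _ _ => dist_nonneg)
        (Finset.mem_univ k)
      linarith
  obtain ⟨ξ, S, hξ0, hS, hle, hsum, hvar⟩ := hA.exists_vectors hR0 hδ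
  have hξ : ∀ x z, |ξ x z| ≤ 1 := fun x z => by
    have := hle x {z}
    rw [Finset.sum_singleton] at this
    exact (sq_le_one_iff_abs_le_one _).1 this
  obtain ⟨E, hE⟩ : ∃ E : Finset G, ∀ g, dist g 1 ≤ S → g ∈ E :=
    ⟨(hgeom.finite_closedBall 1 S).toFinset, fun g hg => by simpa using hg⟩
  -- The functions `z ↦ t k (g * z)`, for all `k` and all `g ∈ E`, are finitely many and bounded, so
  -- one partition of `G` serves them all.
  obtain ⟨n, cl, rep, hrep⟩ := exists_finite_partition
    (fun (z : G) (k : ι × E) => t k.1 (k.2 * z)) (C := ∑ k, C k) (fun z k => (ht _ _).trans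
      (Finset.single_le_sum (f := C) (fun _ _ => hC _) (Finset.mem_univ k.1))) hδ
  refine ⟨Fin n × E, inferInstance, inferInstance, roeCompression rep E,
    CompletelyPositiveMap.ofRow (roeRow hinv hξ cl E), roeCompression_one rep E,
    ofRow_roeRow_one hinv hξ cl hS hE hsum, fun k => ?_⟩
  have hCk : 0 ≤ δ * (1 + C k) := mul_nonneg hδ.le (add_nonneg zero_le_one (hC k))
  refine ContinuousLinearMap.opNorm_le_bound _ hCk fun f => ?_
  -- The difference is a multiplication operator after translation by `s k`; comparison with the
  -- translated `f` makes the estimate pointwise.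
  rw [← (leftTranslation (s k)).norm_map f]
  refine norm_le_of_forall_norm_apply_le hCk fun x => ?_
  have h1 := ofRow_roeRow_roeCompression_apply hinv hξ cl rep hS hE (t k) (C k) (ht k) (s k) f x
  have h2 := norm_weight_sub_le hinv hξ0 cl rep hδ.le hS hE hle hvar (t k) (C k) (ht k)
    (fun h hh z => hrep z ⟨k, ⟨h, hh⟩⟩) (s k) (hR k) x
  have h3 := mul_le_mul_of_nonneg_right h2 (norm_nonneg (f ((s k)⁻¹ * x)))
  rw [← norm_mul, sub_mul, ← h1] at h3
  exact h3

/-- A group with property A has a nuclear uniform Roe algebra. -/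
theorem PropertyA.isNuclearAlgebra (hinv : RightInvariantDist G) (hgeom : BoundedGeometry G)
    (hA : PropertyA G) : IsNuclearAlgebra (uniformRoeAlgebra G) := by
  refine isNuclearAlgebra_of_fintype fun F ε hε => ?_
  have happrox : ∀ a : uniformRoeAlgebra G, ∃ T : ℓ²(G, ℂ) →L[ℂ] ℓ²(G, ℂ),
      FinitePropagation T ∧ ‖(a : ℓ²(G, ℂ) →L[ℂ] ℓ²(G, ℂ)) - T‖ < ε / 60 := fun a => by
    have : (a : ℓ²(G, ℂ) →L[ℂ] ℓ²(G, ℂ)) ∈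
        closure (finitePropagationAlgebra G : Set (ℓ²(G, ℂ) →L[ℂ] ℓ²(G, ℂ))) := a.2
    obtain ⟨T, hT, hd⟩ := Metric.mem_closure_iff.1 this (ε / 60) (by positivity)
    exact ⟨T, hT, by rwa [← dist_eq_norm]⟩
  choose T hT hTd using happrox
  choose s hs using fun a => (hT a).exists_eq_sum hinv hgeom
  have hn : ∀ a, 0 ≤ ((s a).card : ℝ) * (1 + ‖T a‖) := fun a =>
    mul_nonneg (Nat.cast_nonneg _) (add_nonneg zero_le_one (norm_nonneg _))
  obtain ⟨D, hD0, hD⟩ : ∃ D : ℝ, 0 ≤ D ∧ ∀ a ∈ F, (s a).card * (1 + ‖T a‖) ≤ D :=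
    ⟨∑ a ∈ F, (s a).card * (1 + ‖T a‖), Finset.sum_nonneg fun a _ => hn a,
      fun a ha => Finset.single_le_sum (fun a _ => hn a) ha⟩
  obtain ⟨δ, hδ0, hδ⟩ : ∃ δ : ℝ, 0 < δ ∧ δ * (D + 1) = ε / 3 :=
    ⟨ε / 3 / (D + 1), by positivity, by field_simp⟩
  let t : uniformRoeAlgebra G → G → G → ℂ := fun a g x =>
    inner ℂ (deltaVec x) (T a (deltaVec (g⁻¹ * x)))
  have ht : ∀ a g x, ‖t a g x‖ ≤ ‖T a‖ := fun a g x => norm_inner_deltaVec_le _ _ _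
  obtain ⟨J, i₁, i₂, φ, ψ, hφ, hψ, hgen⟩ := hA.exists_factorization hinv hgeom
    (fun k : (a : F) × s a => t k.1 k.2) (fun k => ‖T k.1‖) (fun k => ht k.1 k.2)
    (fun k => (k.2 : G)) hδ0
  refine ⟨J, i₁, i₂, φ, ψ, hφ, hψ, fun a ha => ?_⟩
  let W : G → uniformRoeAlgebra G := fun g =>
    ⟨weightedTranslation (t a g) ‖T a‖ (ht a g) g, weightedTranslation_mem hinv _ _ _ _⟩
  refine norm_sub_factorization_lt hφ hψ (s := s a) (W := W) (c := δ * (1 + ‖T a‖))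
    (fun g hg => hgen ⟨⟨a, ha⟩, ⟨g, hg⟩⟩) ?_ ?_
  · linarith [mul_le_mul_of_nonneg_left (hD a ha) hδ0.le]
  · have hW : ((∑ g ∈ s a, W g : uniformRoeAlgebra G) : ℓ²(G, ℂ) →L[ℂ] ℓ²(G, ℂ)) = T a := by
      rw [AddSubmonoidClass.coe_finsetSum]
      exact (hs a).symm
    change ‖(a : ℓ²(G, ℂ) →L[ℂ] ℓ²(G, ℂ)) - (∑ g ∈ s a, W g : uniformRoeAlgebra G)‖ < ε / 60
    rw [hW]
    exact hTd a

end RoeFactorization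

/-! ### Property A from slowly varying functions and vectors -/

section Discretization

theorem abs_natCeil_sub_natCeil_le {a b : ℝ} (ha : 0 ≤ a) (hb : 0 ≤ b) :
    |(⌈a⌉₊ : ℝ) - ⌈b⌉₊| ≤ |a - b| + 1 := by
  have h1 := Nat.le_ceil a
  have h2 := Nat.le_ceil b
  have h3 := Nat.ceil_lt_add_one ha
  have h4 := Nat.ceil_lt_add_one hb
  have h5 := abs_le.1 (le_refl |a - b|)
  rw [abs_le]
  constructor <;> linarith [h5.1, h5.2]

/-- The region under the graph of a function, over a finite set. -/
def subgraph {X : Type u} (B : Finset X) (a : X → ℕ) : Finset (X × ℕ) :=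
  (B.sigma fun z => Finset.range (a z)).map (Equiv.sigmaEquivProd X ℕ).toEmbedding

theorem mem_subgraph {X : Type u} {B : Finset X} {a : X → ℕ} {p : X × ℕ} :
    p ∈ subgraph B a ↔ p.1 ∈ B ∧ p.2 < a p.1 := by
  simp [subgraph, Finset.mem_map_equiv]

theorem card_subgraph {X : Type u} (B : Finset X) (a : X → ℕ) :
    (subgraph B a).card = ∑ z ∈ B, a z := by
  simp [subgraph]

theorem card_symmDiff_subgraph_le {X : Type u} [DecidableEq X] {B B' Z : Finset X}
    {a a' : X → ℕ} (hB : ∀ z, a z ≠ 0 → z ∈ B) (hB' : ∀ z, a' z ≠ 0 → z ∈ B') (hZ : B ∪ B' ⊆ Z) :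
    ((symmDiff (subgraph B a) (subgraph B' a')).card : ℝ) ≤ ∑ z ∈ Z, |(a z : ℝ) - a' z| := by
  have hsub : symmDiff (subgraph B a) (subgraph B' a') ⊆
      Z.biUnion fun z => {z} ×ˢ Finset.Ico (min (a z) (a' z)) (max (a z) (a' z)) := by
    intro p hp
    rw [Finset.mem_biUnion]
    rw [Finset.mem_symmDiff, mem_subgraph, mem_subgraph] at hp
    refine ⟨p.1, ?_, ?_⟩
    · rcases hp with h | h
      · exact hZ (Finset.mem_union_left _ h.1.1)
      · exact hZ (Finset.mem_union_right _ h.1.1)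
    · rw [Finset.mem_product, Finset.mem_singleton, Finset.mem_Ico]
      refine ⟨rfl, ?_⟩
      rcases hp with ⟨⟨_, h1⟩, h2⟩ | ⟨⟨_, h1⟩, h2⟩
      · have : a' p.1 ≤ p.2 := by
          by_contra! h
          exact h2 ⟨hB' _ (by omega), h⟩
        omega
      · have : a p.1 ≤ p.2 := by
          by_contra! h
          exact h2 ⟨hB _ (by omega), h⟩
        omega
  refine (Nat.cast_le.2 ((Finset.card_le_card hsub).trans Finset.card_biUnion_le)).trans ?_
  rw [Nat.cast_sum]
  refine Finset.sum_le_sum fun z _ => ?_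
  rw [Finset.card_product, Finset.card_singleton, one_mul, Nat.card_Ico]
  rcases le_total (a z) (a' z) with h | h
  · rw [min_eq_left h, max_eq_right h, Nat.cast_sub h, abs_sub_comm]
    exact le_abs_self _
  · rw [min_eq_right h, max_eq_left h, Nat.cast_sub h]
    exact le_abs_self _

theorem card_add_card_eq_two_mul_inter_add_symmDiff {α : Type*} [DecidableEq α] (A B : Finset α) :
    A.card + B.card = 2 * (A ∩ B).card + (symmDiff A B).card := by
  have h1 := Finset.card_sdiff_add_card_inter A B
  have h2 := Finset.card_sdiff_add_card_inter B A
  have h3 : (symmDiff A B).card = (A \ B).card + (B \ A).card := by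
    rw [symmDiff, Finset.sup_eq_union, Finset.card_union_of_disjoint disjoint_sdiff_sdiff]
  rw [Finset.inter_comm] at h2
  omega

theorem BoundedGeometry.exists_card_closedBall_le {X : Type u} [MetricSpace X]
    (hgeom : BoundedGeometry X) (r : ℝ) :
    ∃ N : ℕ, ∀ x, (hgeom.finite_closedBall x r).toFinset.card ≤ N := by
  obtain ⟨N, hN⟩ := hgeom (|r| + 1) (by positivity)
  refine ⟨N, fun x => ?_⟩
  have h1 : (Metric.closedBall x r).encard < N := (Set.encard_le_encard
    (Metric.closedBall_subset_ball (by linarith [le_abs_self r]))).trans_lt (hN x)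
  rw [(hgeom.finite_closedBall x r).encard_eq_coe_toFinset_card] at h1
  exact_mod_cast h1.le

/-- Property A follows from slowly varying nonnegative functions with small support. -/
theorem propertyA_of_functions {X : Type u} [MetricSpace X] (hgeom : BoundedGeometry X)
    (h : ∀ R ε : ℝ, 0 < R → 0 < ε → ∃ (f : X → X → ℝ) (S : ℝ), (∀ x z, 0 ≤ f x z) ∧
      (∀ x z, f x z ≠ 0 → dist x z ≤ S) ∧ (∀ x, ∃ Z : Finset X, 1 / 2 ≤ ∑ z ∈ Z, f x z) ∧
      ∀ x y (Z : Finset X), dist x y ≤ R → ∑ z ∈ Z, |f x z - f y z| ≤ ε) : PropertyA X := by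
  classical
  intro R ε₀ hR hε₀
  -- Rounding costs at most `2 N < K ε` points, so the symmetric difference `D` is at most `2 K ε`.
  -- The two sets have at least `K` points together, so `2 I + D ≥ K`. Then `D < ε₀ I` follows from
  -- `D (2 + ε₀) < ε₀ K`, which this `ε` ensures with a factor `2` to spare.
  set ε : ℝ := ε₀ / (4 * (2 + ε₀)) with hε
  have hε0 : 0 < ε := by positivity
  obtain ⟨f, S, hf0, hfS, hfZ, hfv⟩ := h R ε hR hε0
  obtain ⟨N, hN⟩ := hgeom.exists_card_closedBall_le S
  obtain ⟨K, hK⟩ := exists_nat_gt (2 * N / ε)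
  have hK0 : (0 : ℝ) < K := lt_of_le_of_lt (by positivity) hK
  rw [div_lt_iff₀ hε0] at hK
  let B : X → Finset X := fun x => (hgeom.finite_closedBall x S).toFinset
  have hB : ∀ x z, z ∈ B x ↔ dist x z ≤ S := fun x z => by simp [B, dist_comm]
  -- Rounding up keeps zeros at zero and loses no mass.
  let a : X → X → ℕ := fun x z => ⌈K * f x z⌉₊
  have haB : ∀ x z, a x z ≠ 0 → z ∈ B x := fun x z hz => by
    refine (hB x z).2 (hfS x z fun h0 => hz ?_)
    simp [a, h0]
  have hcard : ∀ x, (K : ℝ) / 2 ≤ (subgraph (B x) (a x)).card := fun x => by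
    obtain ⟨Z, hZ⟩ := hfZ x
    rw [card_subgraph, Nat.cast_sum]
    calc (K : ℝ) / 2 ≤ K * ∑ z ∈ Z, f x z := by nlinarith
      _ = ∑ z ∈ Z, K * f x z := Finset.mul_sum _ _ _
      _ ≤ ∑ z ∈ Z, (a x z : ℝ) := Finset.sum_le_sum fun z _ => Nat.le_ceil _
      _ ≤ ∑ z ∈ Z ∪ B x, (a x z : ℝ) := Finset.sum_le_sum_of_subset_of_nonneg
          Finset.subset_union_left fun _ _ _ => Nat.cast_nonneg _
      _ = ∑ z ∈ B x, (a x z : ℝ) := (Finset.sum_subset Finset.subset_union_right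
          fun z _ hz => by
            by_contra h0
            exact hz (haB x z fun h1 => h0 (by simp [h1]))).symm
  refine ⟨fun x => subgraph (B x) (a x), fun x => ?_, fun x y hxy => ?_, S, fun x p hp => ?_⟩
  · rw [← Finset.card_pos]
    have : (0 : ℝ) < (subgraph (B x) (a x)).card := lt_of_lt_of_le (by positivity) (hcard x)
    exact_mod_cast this
  · have hD : ((symmDiff (subgraph (B x) (a x)) (subgraph (B y) (a y))).card : ℝ) ≤
        2 * K * ε := by
      refine (card_symmDiff_subgraph_le (haB x) (haB y) subset_rfl).trans ?_
      calc ∑ z ∈ B x ∪ B y, |(a x z : ℝ) - a y z|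
          ≤ ∑ z ∈ B x ∪ B y, (K * |f x z - f y z| + 1) := Finset.sum_le_sum fun z _ => by
            refine (abs_natCeil_sub_natCeil_le (mul_nonneg hK0.le (hf0 x z))
              (mul_nonneg hK0.le (hf0 y z))).trans_eq ?_
            rw [← mul_sub, abs_mul, abs_of_pos hK0]
        _ = K * ∑ z ∈ B x ∪ B y, |f x z - f y z| + (B x ∪ B y).card := by
            rw [Finset.sum_add_distrib, Finset.mul_sum, Finset.sum_const, nsmul_eq_mul, mul_one]
        _ ≤ K * ε + 2 * N := by
            have h1 : ((B x ∪ B y).card : ℝ) ≤ (2 * N : ℕ) := by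
              refine Nat.cast_le.2 ((Finset.card_union_le _ _).trans ?_)
              linarith [hN x, hN y]
            push_cast at h1
            have := mul_le_mul_of_nonneg_left (hfv x y (B x ∪ B y) hxy) hK0.le
            linarith
        _ ≤ 2 * K * ε := by linarith
    have hI : (((subgraph (B x) (a x)).card : ℝ) + (subgraph (B y) (a y)).card) =
        2 * ((subgraph (B x) (a x)) ∩ (subgraph (B y) (a y))).card +
          (symmDiff (subgraph (B x) (a x)) (subgraph (B y) (a y))).card := by
      exact_mod_cast card_add_card_eq_two_mul_inter_add_symmDiff _ _
    have hx := hcard x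
    have hy := hcard y
    have hεK : 2 * K * ε * (2 + ε₀) = ε₀ * K / 2 := by
      rw [hε]; field_simp; norm_num
    have h2 : 0 < ε₀ * K := by positivity
    set D : ℝ := ((symmDiff (subgraph (B x) (a x)) (subgraph (B y) (a y))).card : ℝ) with hDdef
    set I : ℝ := (((subgraph (B x) (a x)) ∩ (subgraph (B y) (a y))).card : ℝ) with hIdef
    have h3 : D * (2 + ε₀) < ε₀ * K := by
      have := mul_le_mul_of_nonneg_right hD (show 0 ≤ 2 + ε₀ by positivity)
      linarith
    have h4 : ε₀ * (K - D) ≤ ε₀ * (2 * I) := mul_le_mul_of_nonneg_left (by linarith) hε₀.le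
    have h5 : D < ε₀ * I := by linarith
    convert h5 using 2
  · exact (hB x _).1 (mem_subgraph.1 hp).1

/-- Square norms vary little in `ℓ¹` if the vectors vary little in `ℓ²`. -/
theorem sum_abs_norm_sq_sub_le {X κ H : Type*} [Fintype κ] [NormedAddCommGroup H] (Z : Finset X)
    (w w' : X → κ → H) {α : ℝ} (hα : 0 < α) :
    ∑ z ∈ Z, |∑ k, ‖w z k‖ ^ 2 - ∑ k, ‖w' z k‖ ^ 2| ≤
      (2 * α)⁻¹ * ∑ z ∈ Z, ∑ k, ‖w z k - w' z k‖ ^ 2 +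
        α * (∑ z ∈ Z, ∑ k, ‖w z k‖ ^ 2 + ∑ z ∈ Z, ∑ k, ‖w' z k‖ ^ 2) := by
  -- A weighted arithmetic–geometric mean inequality for `‖x - y‖ (‖x‖ + ‖y‖)`, in place of
  -- Cauchy–Schwarz.
  have key : ∀ x y : H, |‖x‖ ^ 2 - ‖y‖ ^ 2| ≤
      (2 * α)⁻¹ * ‖x - y‖ ^ 2 + α * (‖x‖ ^ 2 + ‖y‖ ^ 2) := fun x y => by
    have h1 : |‖x‖ - ‖y‖| ≤ ‖x - y‖ := abs_norm_sub_norm_le x y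
    have h2 : |‖x‖ ^ 2 - ‖y‖ ^ 2| = |‖x‖ - ‖y‖| * (‖x‖ + ‖y‖) := by
      rw [sq_sub_sq, abs_mul, abs_of_nonneg (a := ‖x‖ + ‖y‖) (by positivity), mul_comm]
    rw [h2]
    have h3 : |‖x‖ - ‖y‖| * (‖x‖ + ‖y‖) ≤ ‖x - y‖ * (‖x‖ + ‖y‖) :=
      mul_le_mul_of_nonneg_right h1 (by positivity)
    refine h3.trans ?_
    set p := ‖x - y‖
    have h4 : (2 * α)⁻¹ * p ^ 2 + α * (‖x‖ ^ 2 + ‖y‖ ^ 2) - p * (‖x‖ + ‖y‖) =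
        (2 * α)⁻¹ * ((p - α * (‖x‖ + ‖y‖)) ^ 2 + α ^ 2 * (‖x‖ - ‖y‖) ^ 2) := by
      field_simp
      ring
    have h5 : 0 ≤ (2 * α)⁻¹ * ((p - α * (‖x‖ + ‖y‖)) ^ 2 + α ^ 2 * (‖x‖ - ‖y‖) ^ 2) := by
      positivity
    linarith
  rw [← Finset.sum_add_distrib, Finset.mul_sum, Finset.mul_sum, ← Finset.sum_add_distrib]
  refine Finset.sum_le_sum fun z _ => ?_
  rw [← Finset.sum_sub_distrib, ← Finset.sum_add_distrib, Finset.mul_sum, Finset.mul_sum,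
    ← Finset.sum_add_distrib]
  exact (Finset.abs_sum_le_sum_abs _ _).trans (Finset.sum_le_sum fun k _ => key _ _)

/-- Slowly varying families of vectors give slowly varying functions. -/
theorem exists_functions_of_vectors {X κ H : Type*} [MetricSpace X] [Fintype κ]
    [NormedAddCommGroup H] [InnerProductSpace ℂ H] {R ε α β : ℝ} (hR : 0 < R) (hα : 0 < α)
    (hβ : β ≤ 1 / 4) (hε : 4 * β * (2 * α)⁻¹ + 3 * α ≤ ε)
    (w : X → X → κ → H) (Y : X → Finset X)
    (u : X → X → ℂ)
    (hu : ∀ x y (Z : Finset X), Y x ⊆ Z → ∑ z ∈ Z, ∑ k, inner ℂ (w x z k) (w y z k) = u x y)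
    (hu1 : ∀ x y, dist x y ≤ R → ‖u x y - 1‖ ≤ β) :
    (∀ x, ∃ Z : Finset X, 1 / 2 ≤ ∑ z ∈ Z, ∑ k, ‖w x z k‖ ^ 2) ∧
      ∀ x y (Z : Finset X), dist x y ≤ R →
        ∑ z ∈ Z, |∑ k, ‖w x z k‖ ^ 2 - ∑ k, ‖w y z k‖ ^ 2| ≤ ε := by
  classical
  have hre : ∀ x y, dist x y ≤ R → |(u x y).re - 1| ≤ β := fun x y h => by
    have := (Complex.abs_re_le_norm (u x y - 1)).trans (hu1 x y h)
    simpa using this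
  have hdiag : ∀ x (Z : Finset X), Y x ⊆ Z → ∑ z ∈ Z, ∑ k, ‖w x z k‖ ^ 2 = (u x x).re := by
    intro x Z hZ
    rw [← hu x x Z hZ, Complex.re_sum]
    refine Finset.sum_congr rfl fun z _ => ?_
    rw [Complex.re_sum]
    exact Finset.sum_congr rfl fun k _ => (inner_self_eq_norm_sq (𝕜 := ℂ) _).symm
  have hself : ∀ x, |(u x x).re - 1| ≤ β := fun x => hre x x (by rw [dist_self]; exact hR.le)
  refine ⟨fun x => ⟨Y x, ?_⟩, fun x y Z hxy => ?_⟩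
  · rw [hdiag x _ subset_rfl]
    have := (abs_le.1 (hself x)).1
    linarith
  · set Z' := Z ∪ (Y x ∪ Y y) with hZ'
    have hx : Y x ⊆ Z' := Finset.subset_union_left.trans Finset.subset_union_right
    have hy : Y y ⊆ Z' := Finset.subset_union_right.trans Finset.subset_union_right
    refine (Finset.sum_le_sum_of_subset_of_nonneg (Finset.subset_union_left (s₂ := Y x ∪ Y y))
      fun _ _ _ => abs_nonneg _).trans ?_
    refine (sum_abs_norm_sq_sub_le Z' (w x) (w y) hα).trans ?_
    have hdiff : ∑ z ∈ Z', ∑ k, ‖w x z k - w y z k‖ ^ 2 =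
        (u x x).re + (u y y).re - 2 * (u x y).re := by
      rw [← hdiag x Z' hx, ← hdiag y Z' hy, ← hu x y Z' hx, Complex.re_sum, Finset.mul_sum,
        ← Finset.sum_add_distrib, ← Finset.sum_sub_distrib]
      refine Finset.sum_congr rfl fun z _ => ?_
      rw [Complex.re_sum, Finset.mul_sum, ← Finset.sum_add_distrib, ← Finset.sum_sub_distrib]
      refine Finset.sum_congr rfl fun k _ => ?_
      have := norm_sub_sq (𝕜 := ℂ) (w x z k) (w y z k)
      rw [this]
      simp only [RCLike.re_to_complex]
      ring
    rw [hdiff, hdiag x Z' hx, hdiag y Z' hy]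
    have h1 := abs_le.1 (hself x)
    have h2 := abs_le.1 (hself y)
    have h3 := abs_le.1 (hre x y hxy)
    -- All three real parts are within `β` of `1`, so the squared distance is at most `2 (1 + β) - 2
    -- (1 - β) = 4 β`.
    have h4 : (2 * α)⁻¹ * ((u x x).re + (u y y).re - 2 * (u x y).re) ≤ (2 * α)⁻¹ * (4 * β) :=
      mul_le_mul_of_nonneg_left (by linarith) (by positivity)
    have h5 : α * ((u x x).re + (u y y).re) ≤ α * 3 :=
      mul_le_mul_of_nonneg_left (by linarith) hα.le
    linarith

end Discretization

/-! ### Approximating completely positive maps on the reduced algebra by finitely supported vectors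
-/

section Approximation

theorem dense_finite_support (X : Type u) :
    Dense {f : ℓ²(X, ℂ) | {x | f x ≠ 0}.Finite} := by
  classical
  intro f
  refine mem_closure_of_tendsto
    (lp.hasSum_single (p := 2) (E := fun _ : X => ℂ) (by norm_num) f)
    (Filter.Eventually.of_forall fun s => ?_)
  refine s.finite_toSet.subset fun x hx => ?_
  by_contra hxs
  refine hx ?_
  rw [lp.coeFn_sum, Finset.sum_apply]
  refine Finset.sum_eq_zero fun i hi => ?_
  rw [lp.single_apply_ne]
  rintro rfl
  exact hxs hi

variable {G : Type u} [Group G]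

/-- The canonical unitaries of the reduced group C⋆-algebra. -/
def reducedUnitary (g : G) : reducedGroupAlgebra G :=
  ⟨leftRegular G g, leftRegular_mem_reducedGroupAlgebra g⟩

theorem reducedUnitary_mul (g h : G) :
    reducedUnitary (g * h) = reducedUnitary g * reducedUnitary h :=
  Subtype.ext (map_mul (leftRegular G) g h)

theorem reducedUnitary_one : reducedUnitary (1 : G) = 1 :=
  Subtype.ext (map_one (leftRegular G))

theorem star_reducedUnitary (g : G) : star (reducedUnitary g) = reducedUnitary g⁻¹ :=
  Subtype.ext (star_leftRegular g)

variable {n : ℕ}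

/-- The functional `∑ c_{gij} φ(λ_g)_{ij}` of a completely positive map `φ` is dominated by its
values on vector functionals. -/
theorem re_sum_apply_nonpos (φ : CompletelyPositiveMap (reducedGroupAlgebra G)
      (CStarMatrix (Fin n) (Fin n) ℂ)) {K : Type*} [Fintype K] (γ : K → G)
    (c : K → Fin n → Fin n → ℂ)
    (hc : ∀ η : Fin n → ℓ²(G, ℂ),
      (∑ i, ∑ j, ∑ g, c g i j * inner ℂ (η i) (leftRegular G (γ g) (η j))).re ≤ 0) :
    (∑ i, ∑ j, ∑ g, c g i j * φ (reducedUnitary (γ g)) i j).re ≤ 0 := by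
  let T : CStarMatrix (Fin n) (Fin n) (reducedGroupAlgebra G) :=
    CStarMatrix.ofMatrix (Matrix.of fun i j => -∑ g, c g i j • reducedUnitary (γ g))
  let ρ := (reducedGroupAlgebra G).subtype
  have hρ : ∀ g, ρ (reducedUnitary g) = leftRegular G g := fun g => rfl
  have hTη : ∀ η : Fin n → ℓ²(G, ℂ), ∑ i, ∑ j, inner ℂ (η i) (ρ (T i j) (η j)) =
      -∑ i, ∑ j, ∑ g, c g i j * inner ℂ (η i) (leftRegular G (γ g) (η j)) := fun η => by
    simp only [T, CStarMatrix.ofMatrix_apply, Matrix.of_apply, map_neg, map_sum, map_smul, hρ,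
      neg_apply, sum_apply, smul_apply, inner_neg_right, inner_sum, inner_smul_right,
      Finset.sum_neg_distrib]
  -- The hypothesis says that the form of `T` has nonnegative real part. The self-adjoint part is
  -- therefore a positive matrix over the reduced algebra, to which complete positivity of `φ`
  -- applies.
  have hpos : 0 ≤ T + star T := by
    refine CStarMatrix.nonneg_of_forall_inner ρ Subtype.val_injective
      (IsSelfAdjoint.add_star_self T) fun η => ?_
    have h1 : ∑ i, ∑ j, inner ℂ (η i) (ρ ((T + star T) i j) (η j)) =
        ∑ i, ∑ j, inner ℂ (η i) (ρ (T i j) (η j)) +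
          star (∑ i, ∑ j, inner ℂ (η i) (ρ (T i j) (η j))) := by
      simp only [CStarMatrix.add_apply, CStarMatrix.star_apply, map_add, map_star, add_apply,
        inner_add_right, Finset.sum_add_distrib, star_sum]
      congr 1
      rw [Finset.sum_comm]
      refine Finset.sum_congr rfl fun i _ => Finset.sum_congr rfl fun j _ => ?_
      rw [ContinuousLinearMap.star_eq_adjoint, ContinuousLinearMap.adjoint_inner_right,
        ← inner_conj_symm, RCLike.star_def]
    rw [h1, hTη, Complex.add_re, RCLike.star_def, Complex.conj_re, Complex.neg_re]
    linarith [hc η]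
  -- Evaluation at the tuple of standard basis vectors extracts the sum of the entries `φ(·) i j` in
  -- block `(i, j)`.
  have h2 := CStarMatrix.re_sum_inner_nonneg (CStarMatrix.stdRep (Fin n))
    (φ.map_cstarMatrix_nonneg _ hpos) fun i => EuclideanSpace.single i (1 : ℂ)
  have h3 : ∀ P : CStarMatrix (Fin n) (Fin n) ℂ, ∀ p q : Fin n,
      inner ℂ (EuclideanSpace.single p (1 : ℂ)) (CStarMatrix.stdRep (Fin n) P
        (EuclideanSpace.single q (1 : ℂ))) = P p q := fun P p q => by
    rw [CStarMatrix.inner_stdRep, Finset.sum_eq_single p, Finset.sum_eq_single q]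
    · simp
    · intro j _ hj; simp [hj]
    · simp
    · intro i _ hi; simp [hi]
    · simp
  have h4 : ∑ i, ∑ j, φ (T i j) i j =
      -∑ i, ∑ j, ∑ g, c g i j * φ (reducedUnitary (γ g)) i j := by
    simp only [T, CStarMatrix.ofMatrix_apply, Matrix.of_apply, map_neg, map_sum, map_smul,
      CStarMatrix.neg_apply, CStarMatrix.sum_apply, CStarMatrix.smul_apply, smul_eq_mul,
      Finset.sum_neg_distrib]
  have h5 : ∑ i, ∑ j, φ ((T + star T) i j) i j =
      ∑ i, ∑ j, φ (T i j) i j + star (∑ i, ∑ j, φ (T i j) i j) := by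
    simp only [CStarMatrix.add_apply, CStarMatrix.star_apply, map_add, map_star,
      Finset.sum_add_distrib, star_sum]
    congr 1
    rw [Finset.sum_comm]
  simp only [h3, CStarMatrix.map_apply] at h2
  rw [h5, h4, Complex.add_re, RCLike.star_def, Complex.conj_re, Complex.neg_re] at h2
  linarith

/-- A completely positive map from the reduced group C⋆-algebra to matrices is, on finitely many
group elements, close to a sum of finitely supported vector functionals. -/
theorem exists_finitely_supported_approx (φ : CompletelyPositiveMap (reducedGroupAlgebra G)
      (CStarMatrix (Fin n) (Fin n) ℂ)) (F : Finset G) {δ : ℝ} (hδ : 0 < δ) :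
    ∃ (ι : Type) (_ : Fintype ι) (η : ι → Fin n → ℓ²(G, ℂ)),
      (∀ m i, {x | η m i x ≠ 0}.Finite) ∧ ∀ g ∈ F, ∀ i j,
        ‖φ (reducedUnitary g) i j - ∑ m, inner ℂ (η m i) (leftRegular G g (η m j))‖ < δ := by
  classical
  let V := F × Fin n × Fin n → ℂ
  let vec : (Fin n → ℓ²(G, ℂ)) → V := fun η k =>
    inner ℂ (η k.2.1) (leftRegular G (k.1 : G) (η k.2.2))
  let 𝒟 : Set (Fin n → ℓ²(G, ℂ)) := Set.univ.pi fun _ => {f : ℓ²(G, ℂ) | {x | f x ≠ 0}.Finite}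
  let v₀ : V := fun k => φ (reducedUnitary (k.1 : G)) k.2.1 k.2.2
  have hsmul : ∀ (r : ℝ) (η : Fin n → ℓ²(G, ℂ)), vec (fun i => (r : ℂ) • η i) =
      ((r ^ 2 : ℝ) : ℂ) • vec η := fun r η => by
    ext k
    change inner ℂ ((r : ℂ) • η k.2.1) (leftRegular G (k.1 : G) ((r : ℂ) • η k.2.2)) =
      ((r ^ 2 : ℝ) : ℂ) * inner ℂ (η k.2.1) (leftRegular G (k.1 : G) (η k.2.2))
    rw [map_smul, inner_smul_left, inner_smul_right, Complex.conj_ofReal]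
    push_cast
    ring
  have hsmulD : ∀ (r : ℝ), ∀ η ∈ 𝒟, (fun i => (r : ℂ) • η i) ∈ 𝒟 := fun r η hη i _ =>
    (hη i trivial).subset fun x hx h0 => hx (by
      rw [lp.coeFn_smul, Pi.smul_apply, h0, smul_zero])
  -- A separating functional would be bounded above on `vec '' 𝒟`, which is stable under positive
  -- scaling, hence nonpositive there; by density it is nonpositive on all vector functionals. Then
  -- `re_sum_apply_nonpos` makes it nonpositive at `v₀`, although it exceeds `u > 0` there.
  have hmem : v₀ ∈ closure (convexHull ℝ (vec '' 𝒟)) := by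
    by_contra hv
    obtain ⟨f, u, hfu, hfv⟩ := RCLike.geometric_hahn_banach_closed_point (𝕜 := ℂ)
      (convex_convexHull ℝ (vec '' 𝒟)).closure isClosed_closure hv
    have hfu' : ∀ η ∈ 𝒟, (f (vec η)).re < u := fun η hη =>
      hfu _ (subset_closure (subset_convexHull ℝ _ ⟨η, hη, rfl⟩))
    have hu : 0 < u := by
      have h0 : (fun _ => 0 : Fin n → ℓ²(G, ℂ)) ∈ 𝒟 := fun i _ => by simp
      have h1 : vec (fun _ => 0) = 0 := funext fun k => inner_zero_left _
      simpa [h1] using hfu' _ h0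
    have hneg : ∀ η ∈ 𝒟, (f (vec η)).re ≤ 0 := fun η hη => by
      by_contra! hpos
      have h1 := hfu' _ (hsmulD (√(u / (f (vec η)).re)) η hη)
      rw [hsmul, map_smul, Real.sq_sqrt (by positivity), smul_eq_mul, Complex.re_ofReal_mul,
        div_mul_cancel₀ _ hpos.ne'] at h1
      exact h1.false
    have hvec : Continuous vec := continuous_pi fun k =>
      (continuous_apply _).inner ((leftRegular G (k.1 : G)).continuous.comp (continuous_apply _))
    have hneg' : ∀ η, (f (vec η)).re ≤ 0 := fun η => by
      have hcl : IsClosed {η | (f (vec η)).re ≤ 0} :=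
        isClosed_le (Complex.continuous_re.comp (f.continuous.comp hvec)) continuous_const
      have hd : Dense 𝒟 := dense_pi _ fun _ _ => dense_finite_support G
      have : closure 𝒟 ⊆ {η | (f (vec η)).re ≤ 0} := hcl.closure_subset_iff.2 hneg
      exact this (hd η)
    let c : F → Fin n → Fin n → ℂ := fun g i j => f (Pi.single (g, i, j) 1)
    have hf : ∀ v : V, f v = ∑ i, ∑ j, ∑ g : F, c g i j * v (g, i, j) := fun v => by
      have h1 : v = ∑ k, v k • Pi.single k (1 : ℂ) := by
        ext k
        simp [Finset.sum_apply, Pi.single_apply]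
      conv_lhs => rw [h1]
      simp only [map_sum, map_smul, Fintype.sum_prod_type, smul_eq_mul]
      rw [Finset.sum_comm]
      refine Finset.sum_congr rfl fun i _ => ?_
      rw [Finset.sum_comm]
      exact Finset.sum_congr rfl fun j _ => Finset.sum_congr rfl fun g _ => mul_comm _ _
    have h1 := re_sum_apply_nonpos φ (fun g : F => (g : G)) c fun η => by
      have := hneg' η
      rwa [hf] at this
    have h2 : u < (f v₀).re := hfv
    rw [hf] at h2
    linarith
  obtain ⟨v, hv, hvd⟩ := Metric.mem_closure_iff.1 hmem δ hδ
  obtain ⟨ι, _, w, z, hw0, -, hz, hsum⟩ := mem_convexHull_iff_exists_fintype.1 hv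
  choose η hηD hη using hz
  -- The square roots of the convex weights are absorbed into the vectors.
  refine ⟨ι, inferInstance, fun m i => ((√(w m) : ℝ) : ℂ) • η m i,
    fun m i => hsmulD _ _ (hηD m) i trivial, fun g hg i j => ?_⟩
  have h1 := (dist_le_pi_dist v₀ v (⟨g, hg⟩, i, j)).trans_lt hvd
  rw [dist_eq_norm] at h1
  have h2 : ∑ m, inner ℂ (((√(w m) : ℝ) : ℂ) • η m i)
      (leftRegular G g (((√(w m) : ℝ) : ℂ) • η m j)) = v (⟨g, hg⟩, i, j) := by
    rw [← hsum, Finset.sum_apply]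
    refine Finset.sum_congr rfl fun m _ => ?_
    have h3 := congrFun (hsmul (√(w m)) (η m)) (⟨g, hg⟩, i, j)
    rw [Real.sq_sqrt (hw0 m)] at h3
    refine h3.trans ?_
    rw [hη]
    rfl
  rw [h2]
  exact h1

end Approximation

/-! ### Exactness of the reduced algebra implies property A -/

section Exact

variable {G : Type u} [Group G]

/-- The substitution `h = s z⁻¹` turns the sum over `z` into the inner product. It trades a kernel
in two variables `s, t` for a function of `s t⁻¹` alone. -/
theorem sum_star_mul_eq_inner [DecidableEq G] (a b : ℓ²(G, ℂ)) (s t : G) (Z : Finset G)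
    (hZ : ∀ z, a (s * z⁻¹) ≠ 0 → z ∈ Z) :
    ∑ z ∈ Z, star (a (s * z⁻¹)) * b (t * z⁻¹) = inner ℂ a (leftRegular G (s * t⁻¹) b) := by
  rw [lp.inner_eq_tsum, tsum_eq_sum (s := Z.image fun z => s * z⁻¹), Finset.sum_image]
  · refine Finset.sum_congr rfl fun z _ => ?_
    simp [mul_comm]
  · intro x _ y _ h
    simpa using h
  · intro h hh
    have : a h = 0 := by
      by_contra h0
      exact hh (Finset.mem_image.2 ⟨h⁻¹ * s, hZ _ (by simpa using h0), by simp⟩)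
    simp [this]

/-- A completely positive map on a matrix algebra is given by operators `C l i` with
`ψ b = ∑ b_{ij} C_{li}⋆ C_{lj}`. -/
theorem CompletelyPositiveMap.exists_kraus {H : Type*} [NormedAddCommGroup H]
    [InnerProductSpace ℂ H] [CompleteSpace H] {n : ℕ}
    (ψ : CompletelyPositiveMap (CStarMatrix (Fin n) (Fin n) ℂ) (H →L[ℂ] H)) :
    ∃ C : Fin n → Fin n → H →L[ℂ] H, ∀ b,
      ψ b = ∑ i, ∑ j, b i j • ∑ l, star (C l i) * C l j := by
  let e : Fin n → Fin n → CStarMatrix (Fin n) (Fin n) ℂ := fun i j =>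
    CStarMatrix.ofMatrix (Matrix.single i j 1)
  -- The Choi matrix of `ψ` is positive because the matrix of matrix units is: its entries are `(e 0
  -- i)⋆ (e 0 j)`. The row `0` exists only for nonzero size, hence the case split.
  have hpos : 0 ≤ (CStarMatrix.ofMatrix (Matrix.of e) :
      CStarMatrix (Fin n) (Fin n) (CStarMatrix (Fin n) (Fin n) ℂ)) := by
    rcases n with _ | n
    · exact le_of_eq (CStarMatrix.ext fun p => p.elim0)
    · refine le_of_le_of_eq (CStarMatrix.star_mul_nonneg fun i => e 0 i)
        (CStarMatrix.ext fun i j => ?_)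
      change CStarMatrix.ofMatrix ((Matrix.single (0 : Fin (n + 1)) i (1 : ℂ)).conjTranspose *
        Matrix.single (0 : Fin (n + 1)) j (1 : ℂ)) = e i j
      simp [e]
  obtain ⟨C, hC⟩ := CStarMatrix.exists_apply_eq_sum_star_mul (ψ.map_cstarMatrix_nonneg _ hpos)
  refine ⟨C, fun b => ?_⟩
  have hb : b = ∑ i, ∑ j, b i j • e i j := by
    ext p q
    simp only [CStarMatrix.sum_apply, CStarMatrix.smul_apply]
    simp [e, Matrix.single_apply, ite_and]
  conv_lhs => rw [hb]
  simp only [map_sum, map_smul]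
  exact Finset.sum_congr rfl fun i _ => Finset.sum_congr rfl fun j _ =>
    congrArg (b i j • ·) (hC i j)

/-- The vectors `w_s(z)` have the matrix coefficients of `ψ` as their Gram matrix. -/
theorem sum_inner_kraus_vectors [DecidableEq G] {H : Type*} [NormedAddCommGroup H]
    [InnerProductSpace ℂ H] [CompleteSpace H] {n : ℕ} {ι : Type*} [Fintype ι]
    (η : ι → Fin n → ℓ²(G, ℂ)) (C : Fin n → Fin n → H →L[ℂ] H) (x y : H) (s t : G)
    (Z : Finset G) (hZ : ∀ m i z, η m i (s * z⁻¹) ≠ 0 → z ∈ Z) :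
    ∑ z ∈ Z, ∑ k : ι × Fin n, inner ℂ (∑ i, η k.1 i (s * z⁻¹) • C k.2 i x)
      (∑ j, η k.1 j (t * z⁻¹) • C k.2 j y) =
    inner ℂ x ((∑ i, ∑ j, (∑ m, inner ℂ (η m i) (leftRegular G (s * t⁻¹) (η m j))) •
      ∑ l, star (C l i) * C l j) y) := by
  have hr : ∀ i j l, inner ℂ (C l i x) (C l j y) = inner ℂ x ((star (C l i) * C l j) y) :=
    fun i j l => by
      rw [ContinuousLinearMap.star_eq_adjoint, mul_apply_eq_comp,
        ContinuousLinearMap.adjoint_inner_right]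
  simp only [sum_apply, smul_apply, inner_sum, sum_inner, inner_smul_left, inner_smul_right,
    Fintype.sum_prod_type, hr, Finset.sum_mul, Finset.mul_sum]
  have : ∀ i j m, inner ℂ (η m i) (leftRegular G (s * t⁻¹) (η m j)) =
    ∑ z ∈ Z, star (η m i (s * z⁻¹)) * η m j (t * z⁻¹) :=
      fun i j m => (sum_star_mul_eq_inner _ _ _ _ Z (hZ m i)).symm
  simp only [this, Finset.sum_mul]
  conv_lhs =>
    rw [Finset.sum_comm]; enter [2, m]; rw [Finset.sum_comm]; enter [2, l]
    rw [Finset.sum_comm]; enter [2, j]; rw [Finset.sum_comm]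
  conv_lhs =>
    rw [Finset.sum_comm]; enter [2, l]; rw [Finset.sum_comm]; enter [2, j]; rw [Finset.sum_comm]
  conv_lhs => rw [Finset.sum_comm]; enter [2, j]; rw [Finset.sum_comm]
  rw [Finset.sum_comm]
  refine Finset.sum_congr rfl fun i _ => Finset.sum_congr rfl fun j _ =>
    Finset.sum_congr rfl fun l _ => Finset.sum_congr rfl fun m _ => Finset.sum_congr rfl fun z _ => ?_
  rw [RCLike.star_def]
  ring

theorem norm_sum_smul_sub_le {E : Type*} [NormedAddCommGroup E] [NormedSpace ℂ E] {n : Type*}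
    [Fintype n] {b b' : n → n → ℂ} {δ : ℝ} (h : ∀ i j, ‖b i j - b' i j‖ ≤ δ) (P : n → n → E) :
    ‖∑ i, ∑ j, b i j • P i j - ∑ i, ∑ j, b' i j • P i j‖ ≤ δ * ∑ i, ∑ j, ‖P i j‖ := by
  simp only [← Finset.sum_sub_distrib, ← sub_smul, Finset.mul_sum]
  refine (norm_sum_le _ _).trans (Finset.sum_le_sum fun i _ => (norm_sum_le _ _).trans
    (Finset.sum_le_sum fun j _ => ?_))
  rw [norm_smul]
  exact mul_le_mul_of_nonneg_right (h i j) (norm_nonneg _)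

theorem norm_map_reducedUnitary {H : Type*} [NormedAddCommGroup H] [InnerProductSpace ℂ H]
    [CompleteSpace H] (π : reducedGroupAlgebra G →⋆ₐ[ℂ] (H →L[ℂ] H)) (g : G) (v : H) :
    ‖π (reducedUnitary g) v‖ = ‖v‖ := by
  have h1 : star (π (reducedUnitary g)) * π (reducedUnitary g) = 1 := by
    rw [← map_star, ← map_mul, star_reducedUnitary, ← reducedUnitary_mul, inv_mul_cancel,
      reducedUnitary_one, map_one]
  have h2 : inner ℂ (π (reducedUnitary g) v) (π (reducedUnitary g) v) = inner ℂ v v := by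
    rw [← ContinuousLinearMap.adjoint_inner_right, ← ContinuousLinearMap.star_eq_adjoint,
      ← mul_apply_eq_comp, h1]
    rfl
  rw [inner_self_eq_norm_sq_to_K, inner_self_eq_norm_sq_to_K] at h2
  have h3 : ‖π (reducedUnitary g) v‖ ^ 2 = ‖v‖ ^ 2 := by exact_mod_cast h2
  exact (pow_left_inj₀ (norm_nonneg _) (norm_nonneg _) two_ne_zero).1 h3

/-- Near a unitary representation, a matrix coefficient along an orbit is near `1`. -/
theorem norm_inner_sub_one_le {H : Type*} [NormedAddCommGroup H] [InnerProductSpace ℂ H]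
    [CompleteSpace H] (π : reducedGroupAlgebra G →⋆ₐ[ℂ] (H →L[ℂ] H)) {v : H} (hv : ‖v‖ = 1)
    (s t : G) {U : H →L[ℂ] H} {β : ℝ} (hU : ‖U - π (reducedUnitary (s * t⁻¹))‖ ≤ β) :
    ‖inner ℂ (π (reducedUnitary s) v) (U (π (reducedUnitary t) v)) - 1‖ ≤ β := by
  have h1 : π (reducedUnitary (s * t⁻¹)) (π (reducedUnitary t) v) = π (reducedUnitary s) v := by
    rw [← mul_apply_eq_comp, ← map_mul, ← reducedUnitary_mul, inv_mul_cancel_right]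
  have h2 : inner ℂ (π (reducedUnitary s) v) (π (reducedUnitary s) v) = (1 : ℂ) := by
    rw [inner_self_eq_norm_sq_to_K, norm_map_reducedUnitary, hv]
    simp
  have h3 : inner ℂ (π (reducedUnitary s) v) (U (π (reducedUnitary t) v)) - 1 =
      inner ℂ (π (reducedUnitary s) v)
        ((U - π (reducedUnitary (s * t⁻¹))) (π (reducedUnitary t) v)) := by
    rw [sub_apply, inner_sub_right, h1, h2]
  rw [h3]
  refine (norm_inner_le_norm _ _).trans ?_
  rw [norm_map_reducedUnitary, hv, one_mul]
  refine (ContinuousLinearMap.le_opNorm _ _).trans ?_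
  rwa [norm_map_reducedUnitary, hv, mul_one]

/-- On a zero Hilbert space injectivity would force `1 = 0` in the reduced algebra, contradicted by
`deltaVec 1`. -/
theorem exists_norm_eq_one_of_injective {H : Type*} [NormedAddCommGroup H]
    [InnerProductSpace ℂ H] [CompleteSpace H] (π : reducedGroupAlgebra G →⋆ₐ[ℂ] (H →L[ℂ] H))
    (hπ : Function.Injective π) : ∃ v : H, ‖v‖ = 1 := by
  rcases subsingleton_or_nontrivial H with hH | hH
  · have h0 : (1 : reducedGroupAlgebra G) = 0 :=
      hπ (ContinuousLinearMap.ext fun x => Subsingleton.elim _ _)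
    have h1 : deltaVec (1 : G) = 0 :=
      congrArg (fun T : reducedGroupAlgebra G =>
        (T : ℓ²(G, ℂ) →L[ℂ] ℓ²(G, ℂ)) (deltaVec (1 : G))) h0
    have h2 := norm_deltaVec (1 : G)
    rw [h1, norm_zero] at h2
    exact absurd h2 zero_ne_one
  · exact exists_norm_eq H zero_le_one

variable [MetricSpace G]

/-- A group with exact reduced C⋆-algebra has property A. -/
theorem IsExactAlgebra.propertyA (hinv : RightInvariantDist G) (hgeom : BoundedGeometry G)
    (h : IsExactAlgebra (reducedGroupAlgebra G)) : PropertyA G := by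
  classical
  obtain ⟨H, _, _, _, π, hπ, hnuc⟩ := h
  obtain ⟨v, hv⟩ := exists_norm_eq_one_of_injective π hπ
  refine propertyA_of_functions hgeom fun R ε hR hε => ?_
  -- With `α = ε / 8` the two error terms are `16 β / ε ≤ ε / 2` and `3 ε / 8`. Half of `β` is spent
  -- on `ψ ∘ φ`, half on the approximation of `φ`.
  obtain ⟨β, hβ0, hβ, hβε⟩ : ∃ β : ℝ, 0 < β ∧ β ≤ 1 / 4 ∧ β ≤ ε ^ 2 / 32 :=
    ⟨min (1 / 4) (ε ^ 2 / 32), by positivity, min_le_left _ _, min_le_right _ _⟩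
  have hαβ : 4 * β * (2 * (ε / 8))⁻¹ + 3 * (ε / 8) ≤ ε := by
    have : 4 * β * (2 * (ε / 8))⁻¹ ≤ ε / 2 := by
      rw [← div_eq_mul_inv, div_le_iff₀ (by positivity)]
      nlinarith
    linarith
  set F : Finset G := (hgeom.finite_closedBall 1 R).toFinset with hF
  have hFmem : ∀ g, dist g 1 ≤ R → g ∈ F := fun g hg => by simpa [hF] using hg
  obtain ⟨n, φ, ψ, -, -, hφψ⟩ := hnuc (F.image reducedUnitary) (β / 2) (by positivity)
  obtain ⟨C, hC⟩ := ψ.exists_kraus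
  set M : ℝ := ∑ i, ∑ j, ‖∑ l, star (C l i) * C l j‖ with hM
  have hM0 : 0 ≤ M := Finset.sum_nonneg fun i _ => Finset.sum_nonneg fun j _ => norm_nonneg _
  obtain ⟨δ, hδ0, hδ⟩ : ∃ δ : ℝ, 0 < δ ∧ δ * (M + 1) = β / 2 :=
    ⟨β / 2 / (M + 1), by positivity, by field_simp⟩
  obtain ⟨ι, _, η, hηfin, hη⟩ := exists_finitely_supported_approx φ F hδ0
  let U : G → H →L[ℂ] H := fun g =>
    ∑ i, ∑ j, (∑ m, inner ℂ (η m i) (leftRegular G g (η m j))) • ∑ l, star (C l i) * C l j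
  have hU : ∀ g ∈ F, ‖U g - π (reducedUnitary g)‖ ≤ β := fun g hg => by
    have h1 : ‖ψ (φ (reducedUnitary g)) - U g‖ ≤ δ * M := by
      rw [hC]
      exact norm_sum_smul_sub_le (fun i j => (hη g hg i j).le) _
    have h2 := hφψ _ (Finset.mem_image_of_mem _ hg)
    have h3 : U g - π (reducedUnitary g) = -(ψ (φ (reducedUnitary g)) - U g) -
        (π (reducedUnitary g) - ψ (φ (reducedUnitary g))) := by abel
    rw [h3]
    refine (norm_sub_le _ _).trans ?_
    rw [norm_neg]
    have h4 : ‖π (reducedUnitary g) - ψ (φ (reducedUnitary g))‖ < β / 2 := h2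
    linarith
  let Q : Finset G := Finset.univ.biUnion fun m => Finset.univ.biUnion fun i =>
    (hηfin m i).toFinset
  have hQ : ∀ m i x, η m i x ≠ 0 → x ∈ Q := fun m i x hx =>
    Finset.mem_biUnion.2 ⟨m, Finset.mem_univ _, Finset.mem_biUnion.2 ⟨i, Finset.mem_univ _,
      (hηfin m i).mem_toFinset.2 hx⟩⟩
  have hS : ∀ x ∈ Q, dist x 1 ≤ ∑ g ∈ Q, dist g 1 := fun x hx =>
    Finset.single_le_sum (f := fun g => dist g 1) (fun _ _ => dist_nonneg) hx
  -- Moving `v` along its orbit under `π` makes the coefficient `⟨π(s) v, π(s t⁻¹) π(t) v⟩` equal to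
  -- `1`; the factor `η (s * z⁻¹)` keeps `w s` supported near `s`.
  let w : G → G → ι × Fin n → H := fun s z k =>
    ∑ i, η k.1 i (s * z⁻¹) • C k.2 i (π (reducedUnitary s) v)
  obtain ⟨h1, h2⟩ := exists_functions_of_vectors (α := ε / 8) hR (by positivity) hβ hαβ w
    (fun s => Q.image fun h => h⁻¹ * s)
    (fun s t => inner ℂ (π (reducedUnitary s) v) (U (s * t⁻¹) (π (reducedUnitary t) v)))
    (fun s t Z hZ => sum_inner_kraus_vectors η C _ _ s t Z fun m i z hz =>
      hZ (Finset.mem_image.2 ⟨s * z⁻¹, hQ m i _ hz, by simp⟩))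
    (fun s t hst => norm_inner_sub_one_le π hv s t
      (hU _ (hFmem _ (by rwa [hinv.dist_mul_inv]))))
  refine ⟨fun s z => ∑ k, ‖w s z k‖ ^ 2, ∑ g ∈ Q, dist g 1,
    fun s z => Finset.sum_nonneg fun k _ => by positivity, fun s z hsz => ?_, h1, h2⟩
  obtain ⟨k, -, hk⟩ := Finset.exists_ne_zero_of_sum_ne_zero hsz
  have hk' : w s z k ≠ 0 := fun h0 => hk (by simp [h0])
  obtain ⟨i, -, hi⟩ := Finset.exists_ne_zero_of_sum_ne_zero hk'
  rw [← hinv.dist_mul_inv]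
  exact hS _ (hQ k.1 i _ fun h0 => hi (by rw [h0, zero_smul]))

end Exact

end

theorem mainTheorem2 {G : Type*} [Group G] [Countable G] [MetricSpace G]
    (hinv : RightInvariantDist G) (hgeom : BoundedGeometry G) :
    List.TFAE
      [IsExactAlgebra (reducedGroupAlgebra G),
        PropertyA G,
        IsNuclearAlgebra (uniformRoeAlgebra G),
        IsExactAlgebra (uniformRoeAlgebra G)] := by
  classical
  tfae_have 1 → 2 := fun h => h.propertyA hinv hgeom
  tfae_have 2 → 3 := fun h => h.isNuclearAlgebra hinv hgeom
  tfae_have 3 → 4 := isExactAlgebra_uniformRoeAlgebra_of_isNuclearAlgebra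
  tfae_have 4 → 1 := isExactAlgebra_reducedGroupAlgebra hinv
  tfae_finish
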